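/- **Definitions.** Let $K$ be a field. A graph $E=(E^0,E^1,r,s)$ is a directed graph with finitely many vertices and edges (loops and parallel edges are allowed); the edge $e$ goes from $s(e)$ to $r(e)$. Its Leavitt path algebra $L_K(E)$ is the $K$-algebra generated by $E^0\cup E^1\cup\{e^*: e\in E^1\}$ subject to: $vw=\delta_{v,w}v$ for $v,w\in E^0$; $s(e)e=er(e)=e$ and $r(e)e^*=e^*s(e)=e^*$ for $e\in E^1$; $e^*f=\delta_{e,f}r(e)$ for $e,f\in E^1$; and $v=\sum_{s(e)=v}ee^*$ for every vertex $v$ that emits at least one edge. It is unital with $1=\sum_{v\in E^0}v$. Ideals are two-sided. A closed simple path based at $v$ is a path $e_1\cdots e_n$, $n\ge1$, from $v$ to $v$ with $s(e_i)\ne v$ for $i\geq 2$; it is a cycle if the $s(e_i)$ are pairwise distinct. A K1 cycle based at $v$ is a cycle $\lambda$ that is the only closed simple path based at $v$. A cycle polynomial is an element $p(\lambda)=\sum_i p_i\lambda^i\in L_K(E)$, where $\lambda$ is a K1 cycle based at a vertex $v$, $\lambda^0=v$, and $p\in K[x]$ satisfies $p(0)\ne0$ and $\deg p\ge1$. A set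 $X\subseteq E^0$ is hereditary if every path that starts in $X$ ends in $X$, and saturated if it contains every vertex $v$ that emits at least one edge and all of whose edges end in $X$. An ideal of $L_K(E)$ is *$\lambda$-reducible* if it is generated by a (possibly empty) set of cycle polynomials together with a (possibly empty) hereditary saturated set of vertices. Let $\mathcal P$ be the set of monic polynomials $p\in K[x]$ with $p\neq 1$ and $p(0)\ne0$, ordered by $p\le q\iff q\mid p$. For ordered sets $A,B$ let $A\times B$ carry the componentwise order, and write $A<B$ for the disjoint union of $A$ and $B$ with every element of $A$ below every element of $B$; single letters such as $0,L,u,v$ denote single elements, and $\mathcal P_e,\mathcal P_f$ denote copies of $\mathcal P$. Consider the nine lattice types - I: $0<L$ - II: $0<\mathcal P<L$ - III: $0<v<\mathcal P<L$ - IV: $0<\mathcal P_f<v<\mathcal P_e<L$ - V: $0<v<L$ - VI: $0<\mathcal P<v<L$ - VII: $\{0<u\}\times\{0<v\}$ - VIII: $\{0<\mathcal P_e<u\}\times\{0<v\}$ - IX: $\{0<\mathcal P_e<u\}\times\{0<\mathcal P_f<v\}$ **Theorem 4.** Let $E$ be a graph with exactly two vertices. Ordered by inclusion, the $\lambda$-reducible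 ideals of $L_K(E)$ form a lattice, which is isomorphic to exactly one of the nine types I–IX, and it is isomorphic to the lattice of $\lambda$-reducible ideals of one of the following 16 graphs. Here $(a,b;c,d)$ denotes the graph with vertices $u,v$, with $a$ loops at $u$, $b$ loops at $v$, $c$ edges from $u$ to $v$ and $d$ edges from $v$ to $u$. The lattices of the 16 graphs are of the following types, so that all nine types occur: - I: $(0,0;1,0)$, $(0,0;2,1)$, $(1,0;1,1)$, $(2,0;0,1)$ - II: $(0,0;1,1)$, $(1,0;0,1)$ - III: $(1,0;1,0)$, $(2,1;0,1)$ - IV: $(1,1;1,0)$ - V: $(2,0;1,0)$, $(2,2;1,0)$ - VI: $(2,1;1,0)$ - VII: $(0,0;0,0)$, $(2,0;0,0)$ - VIII: $(1,0;0,0)$ - IX: $(1,1;0,0)$ -/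

import Mathlib

open Polynomial

/-- A directed graph with vertex set `V` and edge set `Ed`; the edge `e` goes from `s e` to `r e`. -/
structure DirGraph (V : Type*) (Ed : Type*) where
  s : Ed → V
  r : Ed → V

namespace DirGraph

variable {V Ed : Type*} (E : DirGraph V Ed)

/-- `l = [e₁, …, eₙ]`, with `n ≥ 1`, is a path from `v` to `w`. -/
def IsPath (l : List Ed) (v w : V) : Prop :=
  l.IsChain (fun e f => E.r e = E.s f) ∧
    l.head?.map E.s = some v ∧ l.getLast?.map E.r = some w

/-- Closed simple paths based at `v`: closed paths that return to `v` only at their end. -/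
def IsClosedSimplePath (l : List Ed) (v : V) : Prop :=
  E.IsPath l v v ∧ ∀ e ∈ l.tail, E.s e ≠ v

/-- Cycles based at `v`: closed simple paths whose edges have pairwise distinct sources. -/
def IsCycle (l : List Ed) (v : V) : Prop :=
  E.IsClosedSimplePath l v ∧ (l.map E.s).Nodup

/-- `l` is a K1 cycle with base point `v`: it is a cycle, and it is the only closed simple path
based at `v`. -/
def IsK1Cycle (l : List Ed) (v : V) : Prop :=
  E.IsCycle l v ∧ ∀ l' : List Ed, E.IsClosedSimplePath l' v → l' = l

/-- Hereditary sets of vertices (paths of length zero impose no condition). -/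
def IsHereditary (X : Set V) : Prop :=
  ∀ v ∈ X, ∀ (w : V) (l : List Ed), E.IsPath l v w → w ∈ X

/-- Saturated sets of vertices. -/
def IsSaturated (X : Set V) : Prop :=
  ∀ v : V, (∃ e, E.s e = v) → (∀ e, E.s e = v → E.r e ∈ X) → v ∈ X

end DirGraph

/-- The generators of a Leavitt path algebra: vertices, edges, ghost edges. -/
inductive LeavittGen (V : Type*) (Ed : Type*) where
  | vert (v : V)
  | edge (e : Ed)
  | ghost (e : Ed)

section Leavitt

variable (K : Type*) [Field K] {V Ed : Type*} [Fintype V] [DecidableEq V] [Fintype Ed]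

/-- A generator as an element of the free algebra. -/
abbrev leavittGen (g : LeavittGen V Ed) : FreeAlgebra K (LeavittGen V Ed) :=
  FreeAlgebra.ι K g

open LeavittGen in
/-- The defining relations of the Leavitt path algebra of a finite graph. `FreeAlgebra` is the
free *unital* algebra; the relation `one` identifies its unit with the sum of the vertices, which
is the unit of the (non-unital) free algebra modulo the remaining relations. -/
inductive LeavittRel (E : DirGraph V Ed) :
    FreeAlgebra K (LeavittGen V Ed) → FreeAlgebra K (LeavittGen V Ed) → Prop
  | one : LeavittRel E (∑ v : V, leavittGen K (vert v)) 1
  | vertSame (v : V) :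
      LeavittRel E (leavittGen K (vert v) * leavittGen K (vert v)) (leavittGen K (vert v))
  | vertDiff (v w : V) (h : v ≠ w) :
      LeavittRel E (leavittGen K (vert v) * leavittGen K (vert w)) 0
  | edgeRange (e : Ed) :
      LeavittRel E (leavittGen K (edge e) * leavittGen K (vert (E.r e))) (leavittGen K (edge e))
  | edgeSource (e : Ed) :
      LeavittRel E (leavittGen K (vert (E.s e)) * leavittGen K (edge e)) (leavittGen K (edge e))
  | ghostSource (e : Ed) :
      LeavittRel E (leavittGen K (ghost e) * leavittGen K (vert (E.s e))) (leavittGen K (ghost e))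
  | ghostRange (e : Ed) :
      LeavittRel E (leavittGen K (vert (E.r e)) * leavittGen K (ghost e)) (leavittGen K (ghost e))
  | ck1Same (e : Ed) :
      LeavittRel E (leavittGen K (ghost e) * leavittGen K (edge e)) (leavittGen K (vert (E.r e)))
  | ck1Diff (e f : Ed) (h : e ≠ f) :
      LeavittRel E (leavittGen K (ghost e) * leavittGen K (edge f)) 0
  | ck2 (v : V) (h : ∃ e, E.s e = v) :
      LeavittRel E (leavittGen K (vert v))
        (∑ e : Ed with E.s e = v, leavittGen K (edge e) * leavittGen K (ghost e))

/-- The Leavitt path algebra `L_K(E)`. -/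
abbrev LeavittPathAlgebra (E : DirGraph V Ed) : Type _ := RingQuot (LeavittRel K E)

variable (E : DirGraph V Ed)

/-- The image of a generator in `L_K(E)`. -/
noncomputable def lpaGen (g : LeavittGen V Ed) : LeavittPathAlgebra K E :=
  RingQuot.mkAlgHom K (LeavittRel K E) (leavittGen K g)

/-- The element `e₁ ⋯ eₙ` of `L_K(E)`. -/
noncomputable def lpaPath (l : List Ed) : LeavittPathAlgebra K E :=
  (l.map fun e => lpaGen K E (.edge e)).prod

/-- `p(l)` for a closed path `l` based at `v`: the sum of the `pᵢ lⁱ`, with the convention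
`l⁰ = v` (multiplication by `v` does not change the positive powers of `l`). -/
noncomputable def lpaPolyAt (v : V) (l : List Ed) (p : K[X]) : LeavittPathAlgebra K E :=
  lpaGen K E (.vert v) * aeval (lpaPath K E l) p

/-- Cycle polynomials: elements `p(l)` for a K1 cycle `l`, where `p` has nonzero constant term
and is not a monomial. -/
def IsCyclePolynomial (x : LeavittPathAlgebra K E) : Prop :=
  ∃ (v : V) (l : List Ed) (p : K[X]), E.IsK1Cycle l v ∧ p.coeff 0 ≠ 0 ∧ 0 < p.natDegree ∧
    x = lpaPolyAt K E v l p

/-- An ideal is `λ`-reducible if it is generated by a set of cycle polynomials together with a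
hereditary saturated set of vertices (either may be empty). -/
def IsLambdaReducible (I : TwoSidedIdeal (LeavittPathAlgebra K E)) : Prop :=
  ∃ (S : Set (LeavittPathAlgebra K E)) (H : Set V),
    (∀ x ∈ S, IsCyclePolynomial K E x) ∧ E.IsHereditary H ∧ E.IsSaturated H ∧
      I = TwoSidedIdeal.span (S ∪ (fun v => lpaGen K E (.vert v)) '' H)

/-- The `λ`-reducible ideals of `L_K(E)`, ordered by inclusion. -/
abbrev LambdaIdeals : Type _ :=
  {I : TwoSidedIdeal (LeavittPathAlgebra K E) // IsLambdaReducible K E I}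

end Leavitt

/-- The index set of one family `⟨P⟩` of non-graded ideals: the monic polynomials `p ≠ 1` with
`p(0) ≠ 0`. -/
def PolyFamily (K : Type*) [Field K] : Type _ :=
  {p : K[X] // p.Monic ∧ p.coeff 0 ≠ 0 ∧ p ≠ 1}

/-- `p ≤ q` if and only if `q` divides `p`. -/
instance PolyFamily.instPartialOrder (K : Type*) [Field K] : PartialOrder (PolyFamily K) where
  le p q := q.1 ∣ p.1
  le_refl p := dvd_refl p.1
  le_trans _ _ _ h₁ h₂ := dvd_trans h₂ h₁
  le_antisymm p q h₁ h₂ := Subtype.ext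
    (Polynomial.eq_of_monic_of_associated p.2.1 q.2.1 (associated_of_dvd_dvd h₂ h₁))

/-- Names for the nine lattice types. -/
inductive LatticeType where
  | I | II | III | IV | V | VI | VII | VIII | IX

/-- The ordered set `0 < ⟨P⟩ < L`: a family with a least and a greatest element added. -/
abbrev BoundedFamily (K : Type*) [Field K] : Type _ := WithBot (WithTop (PolyFamily K))

/-- `α` is isomorphic, as an ordered set, to the lattice of the given type over `K`. -/
def HasLatticeType (K : Type*) [Field K] (α : Type*) [PartialOrder α] : LatticeType → Prop
  -- 0 < L
  | .I => Nonempty (α ≃o Fin 2)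
  -- 0 < P < L
  | .II => Nonempty (α ≃o BoundedFamily K)
  -- 0 < v < P < L
  | .III => Nonempty (α ≃o WithBot (BoundedFamily K))
  -- 0 < P(f) < v < P(e) < L
  | .IV => Nonempty (α ≃o WithBot (PolyFamily K ⊕ₗ BoundedFamily K))
  -- 0 < v < L
  | .V => Nonempty (α ≃o Fin 3)
  -- 0 < P < v < L
  | .VI => Nonempty (α ≃o WithTop (BoundedFamily K))
  -- {0 < u} × {0 < v}
  | .VII => Nonempty (α ≃o Fin 2 × Fin 2)
  -- {0 < P(e) < u} × {0 < v}
  | .VIII => Nonempty (α ≃o BoundedFamily K × Fin 2)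
  -- {0 < P(e) < u} × {0 < P(f) < v}
  | .IX => Nonempty (α ≃o BoundedFamily K × BoundedFamily K)

/-- The graph with vertices `u = 0` and `v = 1` that has `a` loops at `u`, `b` loops at `v`,
`c` edges from `u` to `v` and `d` edges from `v` to `u`. -/
def twoVertexGraph (a b c d : ℕ) : DirGraph (Fin 2) ((Fin a ⊕ Fin b) ⊕ (Fin c ⊕ Fin d)) where
  s := Sum.elim (Sum.elim (fun _ => 0) (fun _ => 1)) (Sum.elim (fun _ => 0) (fun _ => 1))
  r := Sum.elim (Sum.elim (fun _ => 0) (fun _ => 1)) (Sum.elim (fun _ => 1) (fun _ => 0))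

/-- The sixteen representative graphs, as quadruples
(loops at `u`, loops at `v`, edges `u → v`, edges `v → u`), each with its lattice type. -/
def representativeTable : List ((ℕ × ℕ × ℕ × ℕ) × LatticeType) :=
  [((0, 0, 0, 0), .VII), ((0, 0, 1, 0), .I), ((0, 0, 1, 1), .II), ((0, 0, 2, 1), .I),
   ((1, 0, 0, 0), .VIII), ((1, 0, 1, 0), .III), ((1, 0, 0, 1), .II), ((1, 0, 1, 1), .I),
   ((1, 1, 0, 0), .IX), ((1, 1, 1, 0), .IV),
   ((2, 0, 0, 0), .VII), ((2, 0, 1, 0), .V), ((2, 0, 0, 1), .I),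
   ((2, 1, 1, 0), .VI), ((2, 1, 0, 1), .III),
   ((2, 2, 1, 0), .V)]

/-! ### Paths, hereditary sets and K1 cycles -/

namespace DirGraph

variable {V Ed : Type*} {E : DirGraph V Ed}

/-! Each vertex `w` yields an invariant of an ideal `I`. If no K1 cycle is based at `w`, it is the
truth value of `w ∈ I`. If `λ` is the K1 cycle at `w`, it is the ideal of all `p ∈ K[X]` with `p(λ)
∈ I`. Some `y` satisfies `y λ = w`, so `X` is not a zero divisor modulo this ideal; hence it is `0`,
`(1)` or `(p)` with `p` in the family, which gives the order `0 < P < L`.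

Conversely a value `t` generates an ideal `gen t`, and `gen`, `inv` form a Galois connection
(`VertexInvariant`). A λ-reducible ideal is recovered from its invariants, because its generators
are vertices and cycle polynomials. The hard point is that `gen t` has no larger invariant than `t`.
It is settled by representations that kill a hereditary saturated set `H` of vertices and in which
`λ` acts as a prescribed unit `ξ` (`exists_hom_cycle`); take for `ξ` the image of `X` in `K[X]/J`
with `X` inverted (`XSatIdeal.exists_unit`).

For two vertices the edges between them decide how the invariants interact. Without such edges they
are independent, and the lattice is a product. With edges only from `u` to `v` and a loop at `u`, a
nonzero value at `u` forces `v ∈ I`, so the order at `u` is glued on top of the order at `v`.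
Without a loop at `u`, or with edges both ways, `u` and `v` generate the same ideal and one
invariant suffices. In the two-way case K1 cycles exist only if there are exactly two edges;
otherwise they are the unique loops.

Lattice operations come from the X-saturated ideals of `K[X]`, and order-theoretic properties tell
the nine types apart (`type_eq`). -/

theorem isPath_singleton {e : Ed} {v w : V} : E.IsPath [e] v w ↔ E.s e = v ∧ E.r e = w := by
  simp [IsPath]

theorem isPath_cons_cons {e f : Ed} {l : List Ed} {v w : V} :
    E.IsPath (e :: f :: l) v w ↔ E.s e = v ∧ E.IsPath (f :: l) (E.r e) w := by
  simp only [IsPath, List.isChain_cons_cons, List.head?_cons, Option.map_some, Option.some.injEq,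
    List.getLast?_cons_cons]
  constructor
  · rintro ⟨⟨h1, h2⟩, h3, h4⟩
    exact ⟨h3, h2, h1.symm, h4⟩
  · rintro ⟨h3, h2, h1, h4⟩
    exact ⟨⟨h1.symm, h2⟩, h3, h4⟩

theorem not_isPath_nil {v w : V} : ¬ E.IsPath [] v w := by
  simp [IsPath]

/-- Induction on paths by prepending an edge. -/
theorem IsPath.induction {P : List Ed → V → V → Prop}
    (single : ∀ e, P [e] (E.s e) (E.r e))
    (cons : ∀ e f l w, E.IsPath (f :: l) (E.r e) w → P (f :: l) (E.r e) w →
      P (e :: f :: l) (E.s e) w) :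
    ∀ {l : List Ed} {v w : V}, E.IsPath l v w → P l v w := by
  intro l
  induction l with
  | nil => intro v w h; exact absurd h not_isPath_nil
  | cons e l ih =>
    intro v w h
    cases l with
    | nil =>
      obtain ⟨rfl, rfl⟩ := isPath_singleton.1 h
      exact single e
    | cons f l =>
      obtain ⟨rfl, h'⟩ := isPath_cons_cons.1 h
      exact cons e f l w h' (ih h')

theorem isHereditary_iff {X : Set V} : E.IsHereditary X ↔ ∀ e, E.s e ∈ X → E.r e ∈ X := by
  constructor
  · intro h e he
    exact h _ he _ [e] (isPath_singleton.2 ⟨rfl, rfl⟩)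
  · intro h v hv w l hl
    revert hv
    refine IsPath.induction (P := fun _ v w => v ∈ X → w ∈ X) (fun e => h e) ?_ hl
    intro e f l w _ ih he
    exact ih (h e he)

theorem isClosedSimplePath_loop {e : Ed} {w : V} (hs : E.s e = w) (hr : E.r e = w) :
    E.IsClosedSimplePath [e] w :=
  ⟨isPath_singleton.2 ⟨hs, hr⟩, by simp⟩

/-- If no path leads back to `w` after leaving it, the closed simple paths at `w` are loops. -/
theorem IsClosedSimplePath.eq_loop {w : V}
    (hw : ∀ e, E.s e = w → E.r e ≠ w → ∀ l, ¬ E.IsPath l (E.r e) w) {l : List Ed}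
    (hl : E.IsClosedSimplePath l w) : ∃ e, l = [e] ∧ E.s e = w ∧ E.r e = w := by
  match l, hl with
  | [], hl => exact absurd hl.1 not_isPath_nil
  | [e], hl => exact ⟨e, rfl, isPath_singleton.1 hl.1⟩
  | e :: f :: l, hl =>
    obtain ⟨h1, h2⟩ := isPath_cons_cons.1 hl.1
    refine absurd h2 (hw e h1 ?_ _)
    have h3 : E.s f = E.r e := by simpa using h2.2.1
    rw [← h3]
    exact hl.2 f (by simp)

/-- Without a way back to `w`, every closed simple path at `w` is a loop, so being the only one
amounts to being the only loop. -/
theorem isK1Cycle_iff_of_no_return {w : V}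
    (hw : ∀ e, E.s e = w → E.r e ≠ w → ∀ l, ¬ E.IsPath l (E.r e) w) {l : List Ed} :
    E.IsK1Cycle l w ↔ ∃ e, l = [e] ∧ E.s e = w ∧ E.r e = w ∧
      ∀ f, E.s f = w → E.r f = w → f = e := by
  constructor
  · rintro ⟨⟨h1, h2⟩, h3⟩
    obtain ⟨e, rfl, hs, hr⟩ := h1.eq_loop hw
    refine ⟨e, rfl, hs, hr, fun f hf hf' => ?_⟩
    simpa using h3 [f] (isClosedSimplePath_loop hf hf')
  · rintro ⟨e, rfl, hs, hr, h⟩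
    refine ⟨⟨isClosedSimplePath_loop hs hr, by simp⟩, fun l' hl' => ?_⟩
    obtain ⟨f, rfl, hf, hf'⟩ := hl'.eq_loop hw
    rw [h f hf hf']

end DirGraph

/-! ### Relations and ideals of the Leavitt path algebra -/

namespace Leavitt

variable (K : Type*) [Field K] {V Ed : Type*} [Fintype V] [DecidableEq V] [Fintype Ed]
  (E : DirGraph V Ed)

theorem mk_eq {x y : FreeAlgebra K (LeavittGen V Ed)} (h : LeavittRel K E x y) :
    RingQuot.mkAlgHom K (LeavittRel K E) x = RingQuot.mkAlgHom K (LeavittRel K E) y :=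
  RingQuot.mkAlgHom_rel K h

theorem sum_vert : ∑ v : V, lpaGen K E (.vert v) = 1 := by
  simpa [lpaGen] using mk_eq K E LeavittRel.one

theorem vert_mul_self (v : V) :
    lpaGen K E (.vert v) * lpaGen K E (.vert v) = lpaGen K E (.vert v) := by
  simpa [lpaGen] using mk_eq K E (LeavittRel.vertSame v)

theorem edge_mul_range (e : Ed) :
    lpaGen K E (.edge e) * lpaGen K E (.vert (E.r e)) = lpaGen K E (.edge e) := by
  simpa [lpaGen] using mk_eq K E (LeavittRel.edgeRange e)

theorem source_mul_edge (e : Ed) :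
    lpaGen K E (.vert (E.s e)) * lpaGen K E (.edge e) = lpaGen K E (.edge e) := by
  simpa [lpaGen] using mk_eq K E (LeavittRel.edgeSource e)

theorem ghost_mul_source (e : Ed) :
    lpaGen K E (.ghost e) * lpaGen K E (.vert (E.s e)) = lpaGen K E (.ghost e) := by
  simpa [lpaGen] using mk_eq K E (LeavittRel.ghostSource e)

theorem ghost_mul_edge (e : Ed) :
    lpaGen K E (.ghost e) * lpaGen K E (.edge e) = lpaGen K E (.vert (E.r e)) := by
  simpa [lpaGen] using mk_eq K E (LeavittRel.ck1Same e)

theorem ghost_mul_edge_of_ne {e f : Ed} (h : e ≠ f) :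
    lpaGen K E (.ghost e) * lpaGen K E (.edge f) = 0 := by
  simpa [lpaGen] using mk_eq K E (LeavittRel.ck1Diff e f h)

theorem vert_eq_sum {v : V} (h : ∃ e, E.s e = v) :
    lpaGen K E (.vert v) =
      ∑ e : Ed with E.s e = v, lpaGen K E (.edge e) * lpaGen K E (.ghost e) := by
  simpa [lpaGen] using mk_eq K E (LeavittRel.ck2 v h)

/-- The universal property of the Leavitt path algebra. -/
noncomputable def lift {B : Type*} [Ring B] [Algebra K B] (φ : LeavittGen V Ed → B)
    (h : ∀ x y, LeavittRel K E x y → FreeAlgebra.lift K φ x = FreeAlgebra.lift K φ y) :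
    LeavittPathAlgebra K E →ₐ[K] B :=
  RingQuot.liftAlgHom K ⟨FreeAlgebra.lift K φ, fun x y hxy => h x y hxy⟩

theorem lift_lpaGen {B : Type*} [Ring B] [Algebra K B] (φ : LeavittGen V Ed → B)
    (h : ∀ x y, LeavittRel K E x y → FreeAlgebra.lift K φ x = FreeAlgebra.lift K φ y)
    (g : LeavittGen V Ed) : lift K E φ h (lpaGen K E g) = φ g := by
  simp [lift, lpaGen, leavittGen]

variable {K E}

theorem lpaPath_singleton (e : Ed) : lpaPath K E [e] = lpaGen K E (.edge e) := by
  simp [lpaPath]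

theorem lpaPath_cons (e : Ed) (l : List Ed) :
    lpaPath K E (e :: l) = lpaGen K E (.edge e) * lpaPath K E l := by
  simp [lpaPath]

theorem source_mul_path {l : List Ed} {v w : V} (h : E.IsPath l v w) :
    lpaGen K E (.vert v) * lpaPath K E l = lpaPath K E l := by
  refine DirGraph.IsPath.induction
    (P := fun l v w => lpaGen K E (.vert v) * lpaPath K E l = lpaPath K E l) ?_ ?_ h
  · intro e
    rw [lpaPath_singleton, source_mul_edge]
  · intro e f l w _ _
    rw [lpaPath_cons, ← mul_assoc, source_mul_edge]

theorem path_mul_range {l : List Ed} {v w : V} (h : E.IsPath l v w) :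
    lpaPath K E l * lpaGen K E (.vert w) = lpaPath K E l := by
  refine DirGraph.IsPath.induction
    (P := fun l v w => lpaPath K E l * lpaGen K E (.vert w) = lpaPath K E l) ?_ ?_ h
  · intro e
    rw [lpaPath_singleton, edge_mul_range]
  · intro e f l w _ ih
    rw [lpaPath_cons, mul_assoc, ih]

/-- The witness is the path of ghost edges in reverse order, which cancels edge by edge through CK1.
-/
theorem exists_mul_path {l : List Ed} {v w : V} (h : E.IsPath l v w) :
    ∃ y, y * lpaPath K E l = lpaGen K E (.vert w) := by
  refine DirGraph.IsPath.induction
    (P := fun l v w => ∃ y, y * lpaPath K E l = lpaGen K E (.vert w)) ?_ ?_ h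
  · intro e
    exact ⟨_, by rw [lpaPath_singleton, ghost_mul_edge]⟩
  · rintro e f l w hp ⟨y, hy⟩
    refine ⟨y * lpaGen K E (.ghost e), ?_⟩
    rw [lpaPath_cons, mul_assoc, ← mul_assoc (lpaGen K E (.ghost e)), ghost_mul_edge,
      source_mul_path hp, hy]

section Ideals

variable {I : TwoSidedIdeal (LeavittPathAlgebra K E)}

theorem range_mem {e : Ed} (h : lpaGen K E (.vert (E.s e)) ∈ I) :
    lpaGen K E (.vert (E.r e)) ∈ I := by
  rw [← ghost_mul_edge, ← source_mul_edge]
  exact I.mul_mem_left _ _ (I.mul_mem_right _ _ h)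

/-- By CK2, `v` is a sum of products that factor through the ranges of its edges. For a vertex all
of whose edges lead to one other vertex, this makes the two generate the same ideal. -/
theorem vert_mem_of_range_mem {v : V} (hv : ∃ e, E.s e = v)
    (h : ∀ e, E.s e = v → lpaGen K E (.vert (E.r e)) ∈ I) : lpaGen K E (.vert v) ∈ I := by
  rw [vert_eq_sum K E hv]
  refine I.finsetSum_mem _ _ fun e he => ?_
  rw [← edge_mul_range, mul_assoc]
  exact I.mul_mem_left _ _ (I.mul_mem_right _ _ (h e (by simpa using he)))

theorem eq_top_of_forall_vert_mem (h : ∀ v, lpaGen K E (.vert v) ∈ I) : I = ⊤ := by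
  rw [← I.one_mem_iff, ← sum_vert]
  exact I.finsetSum_mem _ _ fun v _ => h v

variable {l : List Ed} {w : V}

theorem commute_vert_path (h : E.IsPath l w w) :
    Commute (lpaGen K E (.vert w)) (lpaPath K E l) := by
  rw [Commute, SemiconjBy, source_mul_path h, path_mul_range h]

theorem commute_vert_aeval (h : E.IsPath l w w) (p : K[X]) :
    Commute (lpaGen K E (.vert w)) (aeval (lpaPath K E l) p) := by
  induction p using Polynomial.induction_on' with
  | add p q hp hq =>
    rw [map_add]
    exact hp.add_right hq
  | monomial n a =>
    rw [aeval_monomial]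
    exact (Algebra.commute_algebraMap_right a _).mul_right ((commute_vert_path h).pow_right n)

theorem lpaPolyAt_mul (h : E.IsPath l w w) (p q : K[X]) :
    lpaPolyAt K E w l (p * q) = aeval (lpaPath K E l) p * lpaPolyAt K E w l q := by
  rw [lpaPolyAt, lpaPolyAt, map_mul, ← mul_assoc, ← mul_assoc, (commute_vert_aeval h p).eq]

theorem lpaPolyAt_one : lpaPolyAt K E w l 1 = lpaGen K E (.vert w) := by
  simp [lpaPolyAt]

/-- A closed path can be cancelled on the left, by `exists_mul_path`. This is the source of
X-saturation, and hence of the condition `p(0) ≠ 0`. -/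
theorem lpaPolyAt_mem_of_X_mul (h : E.IsPath l w w) {p : K[X]}
    (hp : lpaPolyAt K E w l (X * p) ∈ I) : lpaPolyAt K E w l p ∈ I := by
  obtain ⟨y, hy⟩ := exists_mul_path (K := K) h
  have h1 := I.mul_mem_left y _ hp
  rw [lpaPolyAt_mul h, aeval_X, ← mul_assoc, hy] at h1
  simpa only [lpaPolyAt, ← mul_assoc, vert_mul_self] using h1

/-- A polynomial in a loop `e` at `w` with nonzero constant term generates the ranges of the
other edges that leave `w`. -/
theorem range_mem_of_lpaPolyAt_mem {e f : Ed} (hf : E.s f = w) (hfe : f ≠ e)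
    {p : K[X]} (hp : p.coeff 0 ≠ 0) (h : lpaPolyAt K E w [e] p ∈ I) :
    lpaGen K E (.vert (E.r f)) ∈ I := by
  have h1 := I.mul_mem_right _ (lpaGen K E (.edge f)) (I.mul_mem_left (lpaGen K E (.ghost f)) _ h)
  have h2 : lpaGen K E (.ghost f) * lpaPolyAt K E w [e] p * lpaGen K E (.edge f) =
      algebraMap K _ (p.coeff 0) * lpaGen K E (.vert (E.r f)) := by
    rw [lpaPolyAt, ← mul_assoc, ← hf, ghost_mul_source]
    -- Write `p = X q + p(0)`: the first part dies because `f* e = 0`, and the constant leaves `p(0)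
    -- f* f`.
    conv_lhs => rw [← X_mul_divX_add p]
    rw [map_add, map_mul, aeval_X, aeval_C, lpaPath_singleton, mul_add, ← mul_assoc,
      ghost_mul_edge_of_ne K E hfe, zero_mul, zero_add, ← Algebra.commutes, mul_assoc,
      ghost_mul_edge]
  rw [h2] at h1
  have h3 := I.mul_mem_left (algebraMap K _ (p.coeff 0)⁻¹) _ h1
  rwa [← mul_assoc, ← map_mul, inv_mul_cancel₀ hp, map_one, one_mul] at h3

end Ideals

end Leavitt

/-! ### Representations that kill a hereditary saturated set -/

namespace Leavitt

section Family

/-- Elements of `R` indexed by `F` that identify the module `R` with its `F`-fold power. -/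
structure IsFamily {ι R : Type*} [Ring R] (F : Finset ι) (s t : ι → R) : Prop where
  mul_self : ∀ i ∈ F, t i * s i = 1
  mul_of_ne : ∀ i ∈ F, ∀ j ∈ F, i ≠ j → t i * s j = 0
  sum : ∑ i ∈ F, s i * t i = 1

/-- A bijection `F × ℕ ≃ ℕ` splits `A^ℕ` into copies of itself indexed by `F`; `s i` embeds the
`i`-th copy and `t i` projects onto it. These are CK1 and CK2 at a vertex with several edges. An
empty `F` would give the sum `0` instead of `1`. -/
theorem exists_isFamily {ι : Type*} (A : Type*) [CommRing A] {F : Finset ι} (hF : F.Nonempty) :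
    ∃ s t : ι → Module.End A (ℕ → A), IsFamily F s t := by
  classical
  have : Nonempty F := hF.to_subtype
  obtain ⟨φ⟩ : Nonempty (F × ℕ ≃ ℕ) := nonempty_equiv_of_countable
  let s : ι → Module.End A (ℕ → A) := fun i =>
    { toFun := fun x m => if (φ.symm m).1 = i then x (φ.symm m).2 else 0
      map_add' := fun x y => by ext m; by_cases h : ((φ.symm m).1 : ι) = i <;> simp [h]
      map_smul' := fun a x => by ext m; by_cases h : ((φ.symm m).1 : ι) = i <;> simp [h] }
  let t : ι → Module.End A (ℕ → A) := fun i =>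
    { toFun := fun x n => if h : i ∈ F then x (φ (⟨i, h⟩, n)) else 0
      map_add' := fun x y => by ext n; by_cases h : i ∈ F <;> simp [h]
      map_smul' := fun a x => by ext n; by_cases h : i ∈ F <;> simp [h] }
  refine ⟨s, t, fun i hi => ?_, fun i hi j hj hij => ?_, ?_⟩
  · ext x n
    simp [s, t, hi]
  · ext x n
    simp [s, t, hi, hij]
  · refine LinearMap.ext fun x => funext fun m => ?_
    rw [LinearMap.sum_apply, Finset.sum_apply, Finset.sum_eq_single ((φ.symm m).1 : ι)]
    · simp [s, t]
    · intro i _ hi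
      simp [s, t, hi.symm]
    · intro h
      exact absurd (φ.symm m).1.2 h

/-- For a single edge the identity will do, so that after twisting the edge acts as a scalar. -/
theorem isFamily_singleton {ι R : Type*} [Ring R] (i : ι) :
    IsFamily {i} (fun _ => (1 : R)) fun _ => 1 :=
  ⟨by simp, by simp_all, by simp⟩

/-- Scalars from `A` are central in `R`, so a unit on `s i` and its inverse on `t i` cancel in all
three relations. -/
theorem IsFamily.twist {ι R A : Type*} [Ring R] [CommRing A] [Algebra A R] {F : Finset ι}
    {s t : ι → R} (h : IsFamily F s t) (c : ι → Aˣ) :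
    IsFamily F (fun i => algebraMap A R (c i) * s i)
      fun i => t i * algebraMap A R ((c i)⁻¹ : Aˣ) := by
  have key : ∀ i, algebraMap A R ((c i)⁻¹ : Aˣ) * algebraMap A R (c i) = 1 := fun i => by
    rw [← map_mul, Units.inv_mul, map_one]
  have key' : ∀ i, algebraMap A R (c i) * algebraMap A R ((c i)⁻¹ : Aˣ) = 1 := fun i => by
    rw [← map_mul, Units.mul_inv, map_one]
  refine ⟨fun i hi => ?_, fun i hi j hj hij => ?_, ?_⟩
  · rw [mul_assoc, ← mul_assoc (algebraMap A R _), key, one_mul, h.mul_self i hi]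
  · rw [mul_assoc, ← mul_assoc (algebraMap A R _), ← map_mul, Algebra.commutes, ← mul_assoc,
      h.mul_of_ne i hi j hj hij, zero_mul]
  · rw [← h.sum]
    refine Finset.sum_congr rfl fun i _ => ?_
    rw [mul_assoc, ← mul_assoc (s i), ← Algebra.commutes _ (s i * t i), ← mul_assoc, key', one_mul]

end Family

section Block

variable {V R : Type*} [Ring R] {H : Set V}

open Classical in
/-- The matrix, indexed by the vertices outside `H`, with the only nonzero entry `x` at `(a, b)`. -/
noncomputable def block (H : Set V) (a b : V) (x : R) : Matrix {v // v ∉ H} {v // v ∉ H} R :=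
  Matrix.of fun i j => if i.1 = a ∧ j.1 = b then x else 0

theorem block_eq_zero_left {a b : V} (ha : a ∈ H) (x : R) : block H a b x = 0 := by
  ext i j
  have : i.1 ≠ a := fun h => i.2 (h ▸ ha)
  simp [block, this]

theorem block_eq_zero_right {a b : V} (hb : b ∈ H) (x : R) : block H a b x = 0 := by
  ext i j
  have : j.1 ≠ b := fun h => j.2 (h ▸ hb)
  simp [block, this]

theorem block_zero (a b : V) : block H a b (0 : R) = 0 := by
  ext i j
  simp [block]

theorem block_add (a b : V) (x y : R) : block H a b (x + y) = block H a b x + block H a b y := by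
  ext i j
  by_cases h : i.1 = a ∧ j.1 = b <;> simp [block, h]

theorem block_sum {ι : Type*} (F : Finset ι) (a b : V) (x : ι → R) :
    block H a b (∑ i ∈ F, x i) = ∑ i ∈ F, block H a b (x i) :=
  map_sum (AddMonoidHom.mk' (block H a b) (block_add a b)) x F

theorem block_injective {a : V} (ha : a ∉ H) {x : R} (h : block H a a x = 0) : x = 0 := by
  simpa [block] using congr_fun (congr_fun h ⟨a, ha⟩) ⟨a, ha⟩

variable [Fintype V] [DecidableEq V]

open Classical in
theorem block_mul_block {a b c : V} (hb : b ∉ H) (x y : R) :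
    block H a b x * block H b c y = block H a c (x * y) := by
  ext i j
  rw [Matrix.mul_apply, Finset.sum_eq_single ⟨b, hb⟩]
  · by_cases hi : i.1 = a <;> by_cases hj : j.1 = c <;> simp [block, hi, hj]
  · intro k _ hk
    have : k.1 ≠ b := fun h => hk (Subtype.ext h)
    simp [block, this]
  · simp

open Classical in
theorem block_mul_block_of_ne {a b c d : V} (h : b ≠ c) (x y : R) :
    block H a b x * block H c d y = 0 := by
  ext i j
  rw [Matrix.mul_apply]
  refine Finset.sum_eq_zero fun k _ => ?_
  by_cases hk : k.1 = b
  · have : k.1 ≠ c := fun h' => h (hk.symm.trans h')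
    simp [block, this]
  · simp [block, hk]

open Classical in
theorem sum_block_one : ∑ v : V, block H v v (1 : R) = 1 := by
  ext i j
  rw [Matrix.sum_apply, Finset.sum_eq_single i.1]
  · by_cases h : i = j
    · subst h
      simp [block]
    · have : j.1 ≠ i.1 := fun h' => h (Subtype.ext h'.symm)
      simp [block, h, this]
  · intro v _ hv
    simp [block, hv.symm]
  · simp

end Block

section OutEdges

variable {V Ed : Type*} [Fintype Ed] {E : DirGraph V Ed} {H : Set V}

open Classical in
/-- The edges from `v` whose range is not in `H`. -/
noncomputable def outEdges (E : DirGraph V Ed) (H : Set V) (v : V) : Finset Ed :=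
  {e | E.s e = v ∧ E.r e ∉ H}

theorem mem_outEdges {v : V} {e : Ed} : e ∈ outEdges E H v ↔ E.s e = v ∧ E.r e ∉ H := by
  simp [outEdges]

end OutEdges

section Representation

variable (K : Type*) [Field K] {V Ed : Type*} [Fintype V] [DecidableEq V] [Fintype Ed]
  {E : DirGraph V Ed} {H : Set V}

open Classical in
/-- A choice of families at all vertices outside a hereditary saturated set `H` gives a
representation of the Leavitt path algebra that kills `H`. -/
theorem exists_hom {R : Type*} [Ring R] [Algebra K R] (hH : E.IsHereditary H) {s t : Ed → R}
    (hst : ∀ v ∉ H, (∃ e, E.s e = v) → IsFamily (outEdges E H v) s t) :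
    ∃ π : LeavittPathAlgebra K E →ₐ[K] Matrix {v // v ∉ H} {v // v ∉ H} R,
      (∀ v, π (lpaGen K E (.vert v)) = block H v v 1) ∧
      (∀ e, π (lpaGen K E (.edge e)) = block H (E.s e) (E.r e) (s e)) := by
  let φ : LeavittGen V Ed → Matrix {v // v ∉ H} {v // v ∉ H} R := fun g =>
    match g with
    | .vert v => block H v v 1
    | .edge e => block H (E.s e) (E.r e) (s e)
    | .ghost e => block H (E.r e) (E.s e) (t e)
  have hsr : ∀ {e}, E.r e ∉ H → E.s e ∉ H := fun {e} he hs =>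
    he (DirGraph.isHereditary_iff.1 hH e hs)
  have hφ : ∀ x y, LeavittRel K E x y → FreeAlgebra.lift K φ x = FreeAlgebra.lift K φ y := by
    intro x y hxy
    cases hxy with
    | one => simpa [φ, leavittGen] using sum_block_one (V := V) (R := R) (H := H)
    | vertSame v =>
      by_cases hv : v ∈ H
      · simp [φ, leavittGen, block_eq_zero_left hv]
      · simp [φ, leavittGen, block_mul_block hv]
    | vertDiff v w h => simp [φ, leavittGen, block_mul_block_of_ne h]
    | edgeRange e =>
      by_cases hv : E.r e ∈ H
      · simp [φ, leavittGen, block_eq_zero_right hv]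
      · simp [φ, leavittGen, block_mul_block hv]
    | edgeSource e =>
      by_cases hv : E.s e ∈ H
      · simp [φ, leavittGen, block_eq_zero_left hv]
      · simp [φ, leavittGen, block_mul_block hv]
    | ghostSource e =>
      by_cases hv : E.s e ∈ H
      · simp [φ, leavittGen, block_eq_zero_right hv]
      · simp [φ, leavittGen, block_mul_block hv]
    | ghostRange e =>
      by_cases hv : E.r e ∈ H
      · simp [φ, leavittGen, block_eq_zero_left hv]
      · simp [φ, leavittGen, block_mul_block hv]
    | ck1Same e =>
      by_cases hv : E.r e ∈ H
      · simp [φ, leavittGen, block_eq_zero_left hv, block_eq_zero_right hv]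
      · have h1 := (hst _ (hsr hv) ⟨e, rfl⟩).mul_self e (mem_outEdges.2 ⟨rfl, hv⟩)
        simp [φ, leavittGen, block_mul_block (hsr hv), h1]
    | ck1Diff e f h =>
      by_cases he : E.r e ∈ H
      · simp [φ, leavittGen, block_eq_zero_left he]
      by_cases hf : E.r f ∈ H
      · simp [φ, leavittGen, block_eq_zero_right hf]
      by_cases hs : E.s e = E.s f
      · have h1 := (hst _ (hsr he) ⟨e, rfl⟩).mul_of_ne e (mem_outEdges.2 ⟨rfl, he⟩) f
          (mem_outEdges.2 ⟨hs.symm, hf⟩) h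
        simp [φ, leavittGen, hs, block_mul_block (hsr hf), h1, block_zero]
      · simp [φ, leavittGen, block_mul_block_of_ne hs]
    | ck2 v h =>
      -- CK2 sums over all edges at `v`, the family only over those that avoid `H`; the blocks of
      -- the remaining edges are zero.
      have hr : FreeAlgebra.lift K φ (∑ e : Ed with E.s e = v,
          leavittGen K (.edge e) * leavittGen K (.ghost e)) =
          ∑ e ∈ outEdges E H v, block H v v (s e * t e) := by
        rw [map_sum]
        symm
        refine Finset.sum_subset_zero_on_sdiff ?_ ?_ ?_
        · intro e he
          simpa using (mem_outEdges.1 he).1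
        · intro e he
          simp only [Finset.mem_sdiff, Finset.mem_filter, Finset.mem_univ, true_and,
            mem_outEdges, not_and, not_not] at he
          simp [φ, leavittGen, block_eq_zero_right (he.2 he.1)]
        · intro e he
          obtain ⟨rfl, he'⟩ := mem_outEdges.1 he
          simp [φ, leavittGen, block_mul_block he']
      rw [hr]
      by_cases hv : v ∈ H
      · simp [φ, leavittGen, block_eq_zero_left hv]
      · rw [← block_sum, (hst v hv h).sum]
        simp [φ, leavittGen]
  exact ⟨lift K E φ hφ, fun v => lift_lpaGen K E φ hφ _, fun e => lift_lpaGen K E φ hφ _⟩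

open Classical in
/-- For a hereditary saturated set `H` and units `c e` of a commutative algebra, there is a
representation that kills `H` and in which every edge `e` that is the only edge at its source with
range outside `H` acts as `c e`. -/
theorem exists_twisted_hom {A : Type*} [CommRing A] [Algebra K A] (hH : E.IsHereditary H)
    (hH' : E.IsSaturated H) (c : Ed → Aˣ) :
    ∃ π : LeavittPathAlgebra K E →ₐ[K]
        Matrix {v // v ∉ H} {v // v ∉ H} (Module.End A (ℕ → A)),
      (∀ v, π (lpaGen K E (.vert v)) = block H v v 1) ∧
      (∀ e, E.r e ∉ H → (∀ f, E.s f = E.s e → E.r f ∉ H → f = e) →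
        π (lpaGen K E (.edge e)) = block H (E.s e) (E.r e) (algebraMap A _ (c e))) := by
  have h1 : ∀ v, ∃ s t : Ed → Module.End A (ℕ → A), (outEdges E H v).Nonempty →
      IsFamily (outEdges E H v) s t ∧ (∀ e, outEdges E H v = {e} → s e = 1) := by
    intro v
    by_cases h : ∃ e, outEdges E H v = {e}
    · obtain ⟨e, he⟩ := h
      exact ⟨fun _ => 1, fun _ => 1, fun _ => ⟨he ▸ isFamily_singleton e, fun _ _ => rfl⟩⟩
    · by_cases hn : (outEdges E H v).Nonempty
      · obtain ⟨s, t, hst⟩ := exists_isFamily A hn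
        exact ⟨s, t, fun _ => ⟨hst, fun e he => absurd ⟨e, he⟩ h⟩⟩
      · exact ⟨fun _ => 1, fun _ => 1, fun h => absurd h hn⟩
  choose s t hst using h1
  have hfam : ∀ v ∉ H, (∃ e, E.s e = v) → IsFamily (outEdges E H v)
      (fun e => algebraMap A _ (c e) * s (E.s e) e)
      (fun e => t (E.s e) e * algebraMap A _ ((c e)⁻¹ : Aˣ)) := by
    intro v hv he
    -- Saturation enters here: if all edges at `v` ended in `H`, then `v` would lie in `H`.
    have hne : (outEdges E H v).Nonempty := by
      by_contra hn
      refine hv (hH' v he fun e hev => ?_)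
      by_contra hr
      exact hn ⟨e, mem_outEdges.2 ⟨hev, hr⟩⟩
    have h2 := ((hst v hne).1.twist c)
    refine ⟨fun i hi => ?_, fun i hi j hj hij => ?_, ?_⟩
    · rw [(mem_outEdges.1 hi).1]
      exact h2.mul_self i hi
    · rw [(mem_outEdges.1 hi).1, (mem_outEdges.1 hj).1]
      exact h2.mul_of_ne i hi j hj hij
    · rw [← h2.sum]
      refine Finset.sum_congr rfl fun e he => ?_
      rw [(mem_outEdges.1 he).1]
  obtain ⟨π, hπ, hπ'⟩ := exists_hom K hH hfam
  refine ⟨π, hπ, fun e he huniq => ?_⟩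
  have h3 : outEdges E H (E.s e) = {e} := by
    ext f
    rw [mem_outEdges, Finset.mem_singleton]
    refine ⟨fun h => huniq f h.1 h.2, ?_⟩
    rintro rfl
    exact ⟨rfl, he⟩
  rw [hπ', (hst (E.s e) (h3 ▸ Finset.singleton_nonempty e)).2 e h3, mul_one]

/-- The edges of `l` do not enter `H`, and each is the only such edge at its source. -/
def Isolated (E : DirGraph V Ed) (H : Set V) (l : List Ed) : Prop :=
  ∀ e ∈ l, E.r e ∉ H ∧ ∀ f, E.s f = E.s e → E.r f ∉ H → f = e

-- Isolated edges act as scalars, which simply multiply along the path.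
open Classical in
theorem map_lpaPath {A : Type*} [CommRing A] [Algebra K A] {c : Ed → Aˣ}
    {π : LeavittPathAlgebra K E →ₐ[K] Matrix {v // v ∉ H} {v // v ∉ H} (Module.End A (ℕ → A))}
    (hπ : ∀ e, E.r e ∉ H → (∀ f, E.s f = E.s e → E.r f ∉ H → f = e) →
      π (lpaGen K E (.edge e)) = block H (E.s e) (E.r e) (algebraMap A _ (c e)))
    {l : List Ed} {v w : V} (h : E.IsPath l v w) (hl : Isolated E H l) :
    π (lpaPath K E l) = block H v w (algebraMap A (Module.End A (ℕ → A)) (l.map fun e => (c e : A)).prod) := by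
  revert hl
  refine DirGraph.IsPath.induction (P := fun l v w => Isolated E H l → π (lpaPath K E l) =
    block H v w (algebraMap A (Module.End A (ℕ → A)) (l.map fun e => (c e : A)).prod)) ?_ ?_ h
  · intro e he
    rw [lpaPath_singleton, hπ e (he e (by simp)).1 (he e (by simp)).2]
    simp
  · intro e f l w hp ih he
    have h1 := he e (by simp)
    rw [lpaPath_cons, map_mul, hπ e h1.1 h1.2, ih fun g hg => he g (List.mem_cons_of_mem _ hg),
      block_mul_block h1.1, ← map_mul, List.map_cons (a := e), List.prod_cons]

open Classical in
/-- An isolated cycle acts as a prescribed unit in a suitable representation. -/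
theorem exists_hom_cycle {A : Type*} [CommRing A] [Algebra K A] (hH : E.IsHereditary H)
    (hH' : E.IsSaturated H) {l : List Ed} {w : V} (hl : E.IsClosedSimplePath l w)
    (hi : Isolated E H l) (ξ : Aˣ) :
    ∃ π : LeavittPathAlgebra K E →ₐ[K]
        Matrix {v // v ∉ H} {v // v ∉ H} (Module.End A (ℕ → A)),
      (∀ v, π (lpaGen K E (.vert v)) = block H v v 1) ∧
      (∀ p : K[X], π (lpaPolyAt K E w l p) = block H w w (algebraMap A _ (aeval (ξ : A) p))) := by
  -- A closed simple path leaves `w` exactly once, by its first edge. With `ξ` on the edges that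
  -- leave `w` and `1` on all others, the product along `l` is `ξ`.
  obtain ⟨π, hπ, hπ'⟩ := exists_twisted_hom K hH hH' (fun e => if E.s e = w then ξ else 1)
  refine ⟨π, hπ, fun p => ?_⟩
  have hprod : (l.map fun e => ((if E.s e = w then ξ else 1 : Aˣ) : A)).prod = ξ := by
    cases l with
    | nil => exact absurd hl.1 DirGraph.not_isPath_nil
    | cons e l =>
      have h1 : E.s e = w := by simpa using hl.1.2.1
      have h2 : l.map (fun e => ((if E.s e = w then ξ else 1 : Aˣ) : A)) = l.map fun _ => 1 :=
        List.map_congr_left fun f hf => by simp [hl.2 f hf]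
      rw [List.map_cons, List.prod_cons, h2, if_pos h1]
      simp
  have hpath := map_lpaPath K hπ' hl.1 hi
  rw [hprod] at hpath
  have hw : w ∉ H := by
    have hw' := hl.1.2.2
    rw [Option.map_eq_some_iff] at hw'
    obtain ⟨e, he, rfl⟩ := hw'
    exact (hi e (List.mem_of_getLast? he)).1
  -- The zeroth power is the identity matrix, not the block at `w`; the factor on the left corrects
  -- this.
  have hpow : ∀ n : ℕ, block H w w 1 * block H w w (algebraMap A (Module.End A (ℕ → A)) ξ) ^ n =
      block H w w (algebraMap A _ ((ξ : A) ^ n)) := by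
    intro n
    induction n with
    | zero => simp
    | succ n ih => rw [pow_succ, ← mul_assoc, ih, block_mul_block hw, ← map_mul, pow_succ]
  rw [lpaPolyAt, map_mul, hπ, ← aeval_algHom_apply, hpath]
  induction p using Polynomial.induction_on' with
  | add p q hp hq => rw [map_add, mul_add, hp, hq, map_add, map_add, block_add]
  | monomial n a =>
    rw [aeval_monomial, aeval_monomial, ← mul_assoc, ← Algebra.commutes, mul_assoc, hpow]
    ext i j x m
    by_cases h : i.1 = w ∧ j.1 = w
    · simp [block, h, Algebra.algebraMap_eq_smul_one, Matrix.smul_apply]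
    · simp [block, h, Algebra.algebraMap_eq_smul_one, Matrix.smul_apply]

end Representation

end Leavitt

/-! ### X-saturated ideals of the polynomial ring -/

namespace Leavitt

section XSaturated

variable (K : Type*) [Field K]

/-- The ideals `J` of `K[X]` for which `X` is not a zero divisor modulo `J`. -/
def XSatIdeal : Type _ := {J : Ideal K[X] // ∀ p, X * p ∈ J → p ∈ J}

namespace XSatIdeal

instance : PartialOrder (XSatIdeal K) := inferInstanceAs (PartialOrder (Subtype _))

noncomputable instance : BoundedOrder (XSatIdeal K) where
  top := ⟨⊤, fun _ _ => trivial⟩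
  le_top J := (le_top : J.1 ≤ ⊤)
  bot := ⟨⊥, fun p hp => by
    rw [Ideal.mem_bot] at hp ⊢
    exact (mul_eq_zero.1 hp).resolve_left X_ne_zero⟩
  bot_le J := (bot_le : ⊥ ≤ J.1)

noncomputable instance : InfSet (XSatIdeal K) where
  sInf S := ⟨⨅ J ∈ S, J.1, fun p hp => by
    simp only [Submodule.mem_iInf] at hp ⊢
    exact fun J hJ => J.2 p (hp J hJ)⟩

noncomputable instance : CompleteLattice (XSatIdeal K) :=
  { completeLatticeOfInf (XSatIdeal K) fun S =>
      ⟨fun J hJ => (iInf₂_le J hJ : (⨅ J ∈ S, J.1) ≤ J.1),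
        fun J hJ => (le_iInf₂ fun _ hJ' => hJ hJ' : J.1 ≤ ⨅ J ∈ S, J.1)⟩ with
    toPartialOrder := inferInstance
    top := ⊤
    bot := ⊥
    le_top := fun _ => le_top
    bot_le := fun _ => bot_le }

variable {K}

/-- If a generator were `g = X q`, saturation would put `q` into `J = (X q)`, and comparing degrees
gives `q = 0`. -/
theorem exists_coeff_zero_ne {J : XSatIdeal K} (hJ : J ≠ ⊥) :
    ∃ g : K[X], J.1 = Ideal.span {g} ∧ g.coeff 0 ≠ 0 := by
  obtain ⟨g, hg⟩ := (IsPrincipalIdealRing.principal J.1).principal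
  rw [Ideal.submodule_span_eq] at hg
  refine ⟨g, hg, fun h0 => hJ (Subtype.ext ?_)⟩
  have hg0 : g = 0 := by
    obtain ⟨q, rfl⟩ := X_dvd_iff.2 h0
    have hq : q ∈ J.1 := J.2 q (hg ▸ Ideal.mem_span_singleton_self _)
    rw [hg, Ideal.mem_span_singleton] at hq
    by_contra hne
    have hq0 : q ≠ 0 := right_ne_zero_of_mul hne
    have := degree_le_of_dvd hq hq0
    rw [degree_mul, degree_X, degree_eq_natDegree hq0] at this
    norm_cast at this
    omega
  rw [hg, hg0, Ideal.span_singleton_eq_bot.2 rfl]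
  rfl

/-- The ideal generated by an element of the bounded family: `0`, `(p)` or `(1)`. -/
noncomputable def ofBoundedFamily : BoundedFamily K → XSatIdeal K :=
  WithBot.recBotCoe ⊥ (WithTop.recTopCoe ⊤ fun p => ⟨Ideal.span {p.1}, fun q hq => by
    rw [Ideal.mem_span_singleton] at hq ⊢
    have h1 : IsCoprime p.1 X :=
      ((Polynomial.prime_X.coprime_iff_not_dvd).2 fun h => p.2.2.1 (X_dvd_iff.1 h)).symm
    exact h1.dvd_of_dvd_mul_left hq⟩)

theorem ofBoundedFamily_le_iff (a b : BoundedFamily K) :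
    ofBoundedFamily a ≤ ofBoundedFamily b ↔ a ≤ b := by
  have hcoe : ∀ p : PolyFamily K, (ofBoundedFamily ((p : WithTop (PolyFamily K)) :
      BoundedFamily K)).1 = Ideal.span {p.1} := fun p => rfl
  have h1 : ∀ p : PolyFamily K, (Ideal.span {p.1} : Ideal K[X]) ≠ ⊥ := fun p h =>
    p.2.1.ne_zero (Ideal.span_singleton_eq_bot.1 h)
  have h2 : ∀ p : PolyFamily K, (Ideal.span {p.1} : Ideal K[X]) ≠ ⊤ := fun p h =>
    p.2.2.2 (p.2.1.isUnit_iff.1 (Ideal.span_singleton_eq_top.1 h))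
  have h3 : (⊤ : Ideal K[X]) ≠ ⊥ := top_ne_bot
  change (ofBoundedFamily a).1 ≤ (ofBoundedFamily b).1 ↔ a ≤ b
  have hbot : (ofBoundedFamily (⊥ : BoundedFamily K)).1 = ⊥ := rfl
  have htop : (ofBoundedFamily ((⊤ : WithTop (PolyFamily K)) : BoundedFamily K)).1 = ⊤ := rfl
  induction a using WithBot.recBotCoe with
  | bot => simp [hbot]
  | coe a =>
    induction b using WithBot.recBotCoe with
    | bot =>
      induction a using WithTop.recTopCoe with
      | top =>
        rw [htop, hbot]
        simp
      | coe p =>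
        rw [hcoe, hbot]
        simpa using h1 p
    | coe b =>
      rw [WithBot.coe_le_coe]
      induction b using WithTop.recTopCoe with
      | top =>
        rw [htop]
        simp
      | coe q =>
        induction a using WithTop.recTopCoe with
        | top =>
          rw [hcoe, htop]
          simpa using h2 q
        | coe p =>
          rw [hcoe, hcoe, WithTop.coe_le_coe, Ideal.span_singleton_le_span_singleton]
          rfl

theorem ofBoundedFamily_surjective :
    Function.Surjective (ofBoundedFamily : BoundedFamily K → XSatIdeal K) := by
  classical
  intro J
  by_cases hJ : J = ⊥
  · exact ⟨⊥, hJ.symm⟩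
  by_cases hJ' : J = ⊤
  · exact ⟨((⊤ : WithTop (PolyFamily K)) : BoundedFamily K), hJ'.symm⟩
  obtain ⟨g, hg, h0⟩ := exists_coeff_zero_ne hJ
  have hg0 : g ≠ 0 := fun h => h0 (by simp [h])
  have hspan : Ideal.span {normalize g} = Ideal.span {g} :=
    Ideal.span_singleton_eq_span_singleton.2 (normalize_associated g)
  let p : PolyFamily K := ⟨normalize g, monic_normalize hg0, fun h => by
    rw [← X_dvd_iff, dvd_normalize_iff, X_dvd_iff] at h
    exact h0 h, fun h => hJ' (Subtype.ext (by
      rw [hg, ← hspan, h, Ideal.span_singleton_one]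
      rfl))⟩
  refine ⟨((p : WithTop (PolyFamily K)) : BoundedFamily K), Subtype.ext ?_⟩
  rw [hg, ← hspan]
  rfl

/-- The `X`-saturated ideals of `K[X]` are `0`, `(1)` and the `(p)` with `p` in the family. -/
noncomputable def boundedFamilyIso : BoundedFamily K ≃o XSatIdeal K :=
  RelIso.ofSurjective (OrderEmbedding.ofMapLEIff ofBoundedFamily ofBoundedFamily_le_iff)
    ofBoundedFamily_surjective

/-- Take `A` to be `K[X]/J` localized at the class of `X`, and `ξ` that class. Since `X` is not a
zero divisor modulo `J`, the localization map is injective and no new relations arise. -/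
theorem exists_unit.{u} {K : Type u} [Field K] (J : XSatIdeal K) : ∃ (A : Type u) (_ : CommRing A) (_ : Algebra K A)
    (ξ : Aˣ), ∀ p : K[X], aeval (ξ : A) p = 0 ↔ p ∈ J.1 := by
  let B := K[X] ⧸ J.1
  let x : B := Ideal.Quotient.mk J.1 X
  have hx : x ∈ nonZeroDivisors B := by
    rw [mem_nonZeroDivisors_iff_right]
    intro b hb
    obtain ⟨q, rfl⟩ := Ideal.Quotient.mk_surjective b
    rw [← map_mul, Ideal.Quotient.eq_zero_iff_mem, mul_comm] at hb
    exact Ideal.Quotient.eq_zero_iff_mem.2 (J.2 q hb)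
  have hinj : Function.Injective (algebraMap B (Localization.Away x)) :=
    IsLocalization.injective _ (Submonoid.powers_le.2 hx)
  refine ⟨Localization.Away x, inferInstance, inferInstance,
    (IsLocalization.Away.algebraMap_isUnit x).unit, fun p => ?_⟩
  have h1 : aeval x p = Ideal.Quotient.mk J.1 p := by
    have := aeval_algHom_apply (Ideal.Quotient.mkₐ K J.1) X p
    simpa [x] using this
  rw [IsUnit.unit_spec, aeval_algebraMap_apply, h1, map_eq_zero_iff _ hinj,
    Ideal.Quotient.eq_zero_iff_mem]

end XSatIdeal

end XSaturated

/-! ### The invariant of an ideal at a vertex -/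

section VertexInvariant

variable (K : Type*) [Field K] {V Ed : Type*} [Fintype V] [DecidableEq V] [Fintype Ed]
  (E : DirGraph V Ed)

/-- A classification of the ideals that are generated by the vertex `w` or by cycle polynomials
based at `w`: such ideals are the `gen t`, and `inv I` describes the largest one inside `I`. It is
required that `inv (gen t) = t` modulo the vertices in `H`. -/
structure VertexInvariant (w : V) (H : Set V) (T : Type*) [PartialOrder T] [BoundedOrder T] where
  inv : TwoSidedIdeal (LeavittPathAlgebra K E) → T
  gen : T → TwoSidedIdeal (LeavittPathAlgebra K E)
  gc : GaloisConnection gen inv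
  gen_top : gen ⊤ = TwoSidedIdeal.span {lpaGen K E (.vert w)}
  gen_of_ne_top : ∀ t, t ≠ ⊤ →
    ∃ S, (∀ x ∈ S, IsCyclePolynomial K E x) ∧ gen t = TwoSidedIdeal.span S
  mem_gen_inv : ∀ I l p, E.IsK1Cycle l w → lpaPolyAt K E w l p ∈ I →
    lpaPolyAt K E w l p ∈ gen (inv I)
  separate : ∀ t, t ≠ ⊤ → ∃ I, (∀ z ∈ H, lpaGen K E (.vert z) ∈ I) ∧ gen t ≤ I ∧ inv I ≤ t

variable {K E} {w : V} {H : Set V}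

theorem VertexInvariant.inv_eq_top_iff {T : Type*} [PartialOrder T] [BoundedOrder T]
    (D : VertexInvariant K E w H T) {I : TwoSidedIdeal (LeavittPathAlgebra K E)} :
    D.inv I = ⊤ ↔ lpaGen K E (.vert w) ∈ I := by
  rw [← top_le_iff, ← D.gc, D.gen_top, TwoSidedIdeal.span_le, Set.singleton_subset_iff]
  rfl

/-- Transport of the values of the invariant along an order isomorphism. -/
def VertexInvariant.congr {T T' : Type*} [PartialOrder T] [BoundedOrder T] [PartialOrder T']
    [BoundedOrder T'] (D : VertexInvariant K E w H T) (φ : T ≃o T') :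
    VertexInvariant K E w H T' where
  inv I := φ (D.inv I)
  gen t := D.gen (φ.symm t)
  gc t I := by rw [D.gc, OrderIso.symm_apply_le]
  gen_top := by rw [map_top, D.gen_top]
  gen_of_ne_top t ht := D.gen_of_ne_top _ (by simpa using ht)
  mem_gen_inv I l p hl hp := by simpa using D.mem_gen_inv I l p hl hp
  separate t ht := by
    obtain ⟨I, h1, h2, h3⟩ := D.separate (φ.symm t) (by simpa using ht)
    exact ⟨I, h1, h2, φ.le_symm_apply.1 h3⟩

/-- The invariant of a vertex that is not the base of a K1 cycle. -/
noncomputable def propInvariant (hH : E.IsHereditary H) (hH' : E.IsSaturated H) (hw : w ∉ H)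
    (hl : ∀ l, ¬ E.IsK1Cycle l w) : VertexInvariant K E w H Prop where
  inv I := lpaGen K E (.vert w) ∈ I
  gen P := TwoSidedIdeal.span {x | x = lpaGen K E (.vert w) ∧ P}
  gc P I := by
    rw [TwoSidedIdeal.span_le]
    exact ⟨fun h hP => h ⟨rfl, hP⟩, by rintro h _ ⟨rfl, hP⟩; exact h hP⟩
  gen_top := by congr 1; ext x; simp
  gen_of_ne_top P hP := by
    have : ¬ P := fun h => hP (eq_true h)
    exact ⟨∅, by simp, by simp [this]⟩
  mem_gen_inv I l p h := absurd h (hl l)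
  separate P hP := by
    classical
    have hP' : ¬ P := fun h => hP (eq_true h)
    -- The scalars are irrelevant here; it only matters that the representation kills `H` but not
    -- `w`.
    obtain ⟨π, hπ, -⟩ := exists_twisted_hom (A := K) K hH hH' fun _ => 1
    refine ⟨TwoSidedIdeal.ker π, fun z hz => ?_, ?_, fun h => ?_⟩
    · rw [TwoSidedIdeal.mem_ker, hπ, block_eq_zero_left hz]
    · rw [TwoSidedIdeal.span_le]
      rintro x ⟨-, h⟩
      exact absurd h hP'
    · rw [TwoSidedIdeal.mem_ker, hπ] at h
      exact absurd (block_injective hw h) one_ne_zero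

/-- The polynomials `p` for which `p(l)` lies in the ideal `I`. -/
def polyIdeal {l : List Ed} (hl : E.IsPath l w w) (I : TwoSidedIdeal (LeavittPathAlgebra K E)) :
    XSatIdeal K :=
  ⟨{ carrier := {p | lpaPolyAt K E w l p ∈ I}
     add_mem' := fun {p q} hp hq => by
       have h : lpaPolyAt K E w l (p + q) = lpaPolyAt K E w l p + lpaPolyAt K E w l q := by
         rw [lpaPolyAt, map_add, mul_add]
         rfl
       simp only [Set.mem_ofPred_eq, h]
       exact I.add_mem hp hq
     zero_mem' := by
       simp only [Set.mem_ofPred_eq, lpaPolyAt, map_zero, mul_zero]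
       exact I.zero_mem
     smul_mem' := fun p q hq => by
       simp only [Set.mem_ofPred_eq, smul_eq_mul, lpaPolyAt_mul hl]
       exact I.mul_mem_left _ _ hq },
   fun _ hp => lpaPolyAt_mem_of_X_mul hl hp⟩

theorem mem_polyIdeal {l : List Ed} (hl : E.IsPath l w w)
    {I : TwoSidedIdeal (LeavittPathAlgebra K E)} {p : K[X]} :
    p ∈ (polyIdeal hl I).1 ↔ lpaPolyAt K E w l p ∈ I := Iff.rfl

/-- The invariant of a vertex that is the base of a K1 cycle. -/
noncomputable def polyInvariant (hH : E.IsHereditary H) (hH' : E.IsSaturated H) {l : List Ed}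
    (hl : E.IsK1Cycle l w) (hi : Isolated E H l) : VertexInvariant K E w H (XSatIdeal K) where
  inv := polyIdeal hl.1.1.1
  gen J := TwoSidedIdeal.span (lpaPolyAt K E w l '' J.1)
  gc J I := by
    rw [TwoSidedIdeal.span_le, Set.image_subset_iff]
    rfl
  gen_top := by
    apply le_antisymm <;> rw [TwoSidedIdeal.span_le]
    · rintro _ ⟨p, -, rfl⟩
      have h := lpaPolyAt_mul (K := K) hl.1.1.1 p 1
      rw [mul_one, lpaPolyAt_one] at h
      rw [h]
      exact TwoSidedIdeal.mul_mem_left _ _ _ (TwoSidedIdeal.subset_span rfl)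
    · rintro _ rfl
      exact TwoSidedIdeal.subset_span ⟨1, trivial, lpaPolyAt_one⟩
  gen_of_ne_top J hJ := by
    by_cases hJ0 : J = ⊥
    · refine ⟨∅, by simp, le_antisymm ?_ ?_⟩ <;> rw [TwoSidedIdeal.span_le]
      · rintro _ ⟨p, hp, rfl⟩
        have hp0 : p = 0 := by
          rw [hJ0] at hp
          exact hp
        rw [hp0, lpaPolyAt, map_zero, mul_zero]
        exact TwoSidedIdeal.zero_mem _
      · simp
    obtain ⟨g, hg, h0⟩ := XSatIdeal.exists_coeff_zero_ne hJ0
    refine ⟨{lpaPolyAt K E w l g}, ?_, le_antisymm ?_ ?_⟩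
    · rintro _ rfl
      -- A constant `g` with `g(0) ≠ 0` would be a unit and make `J` the whole ring, so `g` has
      -- positive degree.
      refine ⟨w, l, g, hl, h0, Nat.pos_of_ne_zero fun hd => hJ (Subtype.ext ?_), rfl⟩
      rw [hg]
      refine Ideal.span_singleton_eq_top.2 ?_
      rw [eq_C_of_natDegree_eq_zero hd]
      exact isUnit_C.2 h0.isUnit
    · rw [TwoSidedIdeal.span_le]
      rintro _ ⟨p, hp, rfl⟩
      rw [hg, SetLike.mem_coe, Ideal.mem_span_singleton'] at hp
      obtain ⟨q, rfl⟩ := hp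
      rw [lpaPolyAt_mul hl.1.1.1]
      exact TwoSidedIdeal.mul_mem_left _ _ _ (TwoSidedIdeal.subset_span rfl)
    · refine TwoSidedIdeal.span_mono ?_
      rintro _ rfl
      exact ⟨g, hg ▸ Ideal.mem_span_singleton_self g, rfl⟩
  mem_gen_inv I l' p hl' hp := by
    obtain rfl := hl.2 l' hl'.1.1
    exact TwoSidedIdeal.subset_span ⟨p, hp, rfl⟩
  separate J hJ := by
    classical
    -- Letting the cycle act as `ξ`, the kernel contains `p(l)` exactly for `p ∈ J`.
    obtain ⟨A, _, _, ξ, hξ⟩ := J.exists_unit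
    obtain ⟨π, hπ, hπ'⟩ := exists_hom_cycle K hH hH' hl.1.1 hi ξ
    have hw : w ∉ H := by
      have hw' := hl.1.1.1.2.2
      rw [Option.map_eq_some_iff] at hw'
      obtain ⟨e, he, rfl⟩ := hw'
      exact (hi e (List.mem_of_getLast? he)).1
    refine ⟨TwoSidedIdeal.ker π, fun z hz => ?_, ?_, fun p hp => ?_⟩
    · rw [TwoSidedIdeal.mem_ker, hπ, block_eq_zero_left hz]
    · rw [TwoSidedIdeal.span_le]
      rintro _ ⟨p, hp, rfl⟩
      rw [SetLike.mem_coe, TwoSidedIdeal.mem_ker, hπ', (hξ p).2 hp, map_zero, block_zero]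
    · rw [mem_polyIdeal, TwoSidedIdeal.mem_ker, hπ'] at hp
      have h1 := block_injective hw hp
      rw [← hξ]
      -- A scalar that acts as zero on `A^ℕ` is zero: apply it to the constant sequence `1`.
      simpa using congr_fun (LinearMap.congr_fun h1 (fun _ => 1)) 0

end VertexInvariant

end Leavitt

/-! ### Cycles in graphs with two vertices -/

namespace DirGraph

variable {V Ed : Type*} {E : DirGraph V Ed} {u v w : V}

theorem isHereditary_empty : E.IsHereditary ∅ := fun _ h => h.elim

theorem isSaturated_empty : E.IsSaturated ∅ := fun _ ⟨e, he⟩ h => h e he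

theorem isHereditary_univ : E.IsHereditary Set.univ := fun _ _ _ _ _ => trivial

theorem isSaturated_univ : E.IsSaturated Set.univ := fun _ _ _ => trivial

/-- If all edges at a vertex end in `X`, then so does its loop, whose range is the vertex itself. -/
theorem isSaturated_of_loops (h : ∀ e, ∃ f, E.s f = E.s e ∧ E.r f = E.s e) (X : Set V) :
    E.IsSaturated X := by
  rintro _ ⟨e, rfl⟩ hX
  obtain ⟨f, hf, hf'⟩ := h e
  exact hf' ▸ hX f hf

/-- There is exactly one loop at `w`. -/
def HasUniqueLoop (E : DirGraph V Ed) (w : V) : Prop :=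
  ∃ e, E.s e = w ∧ E.r e = w ∧ ∀ f, E.s f = w → E.r f = w → f = e

/-- No path that leaves `w` through an edge that is not a loop leads back to `w`. -/
def NoReturn (E : DirGraph V Ed) (w : V) : Prop :=
  ∀ e, E.s e = w → E.r e ≠ w → ∀ l, ¬ E.IsPath l (E.r e) w

theorem noReturn_of_forall_loop (h : ∀ e, E.s e = w → E.r e = w) : E.NoReturn w :=
  fun e he he' => absurd (h e he) he'

theorem noReturn_of_hereditary (hV : ∀ x, x = u ∨ x = v) (huv : u ≠ v)
    (h : ∀ e, E.s e = v → E.r e = v) : E.NoReturn u := by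
  intro e _ hr l hl
  have h1 : E.IsHereditary {v} := isHereditary_iff.2 fun e he => h e he
  exact huv (h1 _ ((hV _).resolve_left hr) _ _ hl)

theorem not_isK1Cycle_of_noReturn (hw : E.NoReturn w) (hl : ¬ E.HasUniqueLoop w) (l : List Ed) :
    ¬ E.IsK1Cycle l w := by
  rw [isK1Cycle_iff_of_no_return hw]
  rintro ⟨e, -, he⟩
  exact hl ⟨e, he⟩

theorem isClosedSimplePath_pair {e f : Ed} (he : E.s e = u) (he' : E.r e = v) (hf : E.s f = v)
    (hf' : E.r f = u) (huv : u ≠ v) : E.IsClosedSimplePath [f, e] v := by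
  refine ⟨isPath_cons_cons.2 ⟨hf, isPath_singleton.2 ⟨he.trans hf'.symm, he'⟩⟩, fun g hg => ?_⟩
  obtain rfl : g = e := by simpa using hg
  rw [he]
  exact huv

/-- Each vertex emits a single edge, so a path from `v` has no choice, and it must stop on its first
return. -/
theorem isK1Cycle_pair {e f : Ed} (he : E.s e = u) (he' : E.r e = v) (hf : E.s f = v)
    (hf' : E.r f = u) (huv : u ≠ v) (h : ∀ g, g = e ∨ g = f) : E.IsK1Cycle [f, e] v := by
  have hu : ∀ g, E.s g = u → g = e := fun g hg => (h g).resolve_right fun h' =>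
    huv (by rw [← hg, h', hf])
  have hv : ∀ g, E.s g = v → g = f := fun g hg => (h g).resolve_left fun h' =>
    huv (by rw [← hg, h', he])
  refine ⟨⟨isClosedSimplePath_pair he he' hf hf' huv, by simp [he, hf, huv.symm]⟩, ?_⟩
  intro l hl
  match l, hl with
  | [], hl => exact absurd hl.1 not_isPath_nil
  | [a], hl =>
    obtain ⟨h1, h2⟩ := isPath_singleton.1 hl.1
    rw [hv a h1, hf'] at h2
    exact absurd h2 huv
  | [a, b], hl =>
    obtain ⟨h1, h2⟩ := isPath_cons_cons.1 hl.1
    obtain ⟨h3, -⟩ := isPath_singleton.1 h2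
    obtain rfl := hv a h1
    rw [hu b (h3.trans hf')]
  | a :: b :: c :: l, hl =>
    obtain ⟨h1, h2⟩ := isPath_cons_cons.1 hl.1
    obtain ⟨h3, h4⟩ := isPath_cons_cons.1 h2
    obtain rfl := hv a h1
    obtain rfl := hu b (h3.trans hf')
    have h5 : E.s c = E.r b := by simpa using h4.2.1
    exact absurd (h5.trans he') (hl.2 c (by simp))

/-- Wherever the third edge `g` lies, it yields a second closed simple path at `v`: `f g e`, `f g`,
`g e` or `g`. -/
theorem not_isK1Cycle_of_three_edges (hV : ∀ x, x = u ∨ x = v) {e f g : Ed} (he : E.s e = u)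
    (he' : E.r e = v) (hf : E.s f = v) (hf' : E.r f = u) (huv : u ≠ v) (hge : g ≠ e) (hgf : g ≠ f)
    (l : List Ed) : ¬ E.IsK1Cycle l v := by
  rintro ⟨-, h⟩
  have h1 : ∀ l', E.IsClosedSimplePath l' v → l' = [f, e] := fun l' hl' =>
    (h l' hl').trans (h _ (isClosedSimplePath_pair he he' hf hf' huv)).symm
  rcases hV (E.s g) with hs | hs <;> rcases hV (E.r g) with hr | hr
  · have h2 : E.IsClosedSimplePath [f, g, e] v := by
      refine ⟨isPath_cons_cons.2 ⟨hf, isPath_cons_cons.2 ⟨hs.trans hf'.symm,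
        isPath_singleton.2 ⟨he.trans hr.symm, he'⟩⟩⟩, ?_⟩
      simp [hs, he, huv]
    simpa using h1 _ h2
  · have h2 := h1 _ (isClosedSimplePath_pair hs hr hf hf' huv)
    exact hge (by simpa using h2)
  · have h2 := h1 _ (isClosedSimplePath_pair he he' hs hr huv)
    exact hgf (by simpa using h2)
  · simpa using h1 _ (isClosedSimplePath_loop hs hr)

end DirGraph

/-! ### Assembling the λ-reducible ideals from vertex invariants -/

namespace Leavitt

open DirGraph

variable {K : Type*} [Field K] {V Ed : Type*} [Fintype V] [DecidableEq V] [Fintype Ed]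
  {E : DirGraph V Ed} {u v w : V} {H : Set V}

/-- A Galois connection that recovers all `λ`-reducible ideals identifies them with the set of
its values. -/
def lambdaIdealsIso {T : Type*} [PartialOrder T]
    {g : T → TwoSidedIdeal (LeavittPathAlgebra K E)}
    {f : TwoSidedIdeal (LeavittPathAlgebra K E) → T} (gc : GaloisConnection g f) (P : T → Prop)
    (hP : ∀ I, IsLambdaReducible K E I → P (f I)) (hg : ∀ t, P t → IsLambdaReducible K E (g t))
    (hfg : ∀ t, P t → f (g t) ≤ t) (hgf : ∀ I, IsLambdaReducible K E I → I ≤ g (f I)) :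
    LambdaIdeals K E ≃o {t : T // P t} where
  toFun I := ⟨f I.1, hP I.1 I.2⟩
  invFun t := ⟨g t.1, hg t.1 t.2⟩
  left_inv I := Subtype.ext (le_antisymm (gc.l_u_le _) (hgf I.1 I.2))
  right_inv t := Subtype.ext (le_antisymm (hfg t.1 t.2) (gc.le_u_l _))
  map_rel_iff' {I J} := by
    change f I.1 ≤ f J.1 ↔ I.1 ≤ J.1
    rw [← gc]
    exact ⟨(hgf I.1 I.2).trans, (gc.l_u_le _).trans⟩

section

variable {T T' : Type*} [PartialOrder T] [BoundedOrder T] [PartialOrder T'] [BoundedOrder T']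
  {H' : Set V}

theorem VertexInvariant.vert_mem_gen_inv (D : VertexInvariant K E w H T)
    {I : TwoSidedIdeal (LeavittPathAlgebra K E)} (h : lpaGen K E (.vert w) ∈ I) :
    lpaGen K E (.vert w) ∈ D.gen (D.inv I) := by
  rw [D.inv_eq_top_iff.2 h, D.gen_top]
  exact TwoSidedIdeal.subset_span rfl

theorem VertexInvariant.gen_le_of_vert_mem (D : VertexInvariant K E w H T)
    {I : TwoSidedIdeal (LeavittPathAlgebra K E)} (h : lpaGen K E (.vert w) ∈ I) (t : T) :
    D.gen t ≤ I := by
  rw [D.gc, D.inv_eq_top_iff.2 h]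
  exact le_top

/-- The ideal that separates `t` contains the vertices in `H`, hence also `J`, so joining `J` cannot
raise the invariant. `J` plays the contribution of the other vertex. -/
theorem VertexInvariant.inv_sup_le (D : VertexInvariant K E w H T) (t : T)
    {J : TwoSidedIdeal (LeavittPathAlgebra K E)}
    (hJ : t ≠ ⊤ → ∀ I : TwoSidedIdeal (LeavittPathAlgebra K E),
      (∀ z ∈ H, lpaGen K E (.vert z) ∈ I) → J ≤ I) :
    D.inv (D.gen t ⊔ J) ≤ t := by
  by_cases ht : t = ⊤
  · rw [ht]
    exact le_top
  · obtain ⟨I, h1, h2, h3⟩ := D.separate t ht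
    exact (D.gc.monotone_u (sup_le h2 (hJ ht I h1))).trans h3

theorem VertexInvariant.exists_gen_eq (D : VertexInvariant K E w H T) (t : T) :
    ∃ S, (∀ x ∈ S, IsCyclePolynomial K E x) ∧
      D.gen t = TwoSidedIdeal.span (S ∪ {x | x = lpaGen K E (.vert w) ∧ t = ⊤}) := by
  by_cases ht : t = ⊤
  · refine ⟨∅, by simp, ?_⟩
    subst ht
    rw [D.gen_top]
    congr 1
    ext x
    simp
  · obtain ⟨S, h1, h2⟩ := D.gen_of_ne_top t ht
    exact ⟨S, h1, by simp [h2, ht]⟩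

/-- The `λ`-reducible ideals of a graph with two vertices, by means of their invariants. -/
def pairIso (hV : ∀ x, x = u ∨ x = v) (D : VertexInvariant K E u {v} T)
    (D' : VertexInvariant K E v H' T') (P : T × T' → Prop)
    (hP : ∀ I, P (D.inv I, D'.inv I))
    (hher : ∀ t, P t → E.IsHereditary {z | (z = u ∧ t.1 = ⊤) ∨ (z = v ∧ t.2 = ⊤)} ∧
      E.IsSaturated {z | (z = u ∧ t.1 = ⊤) ∨ (z = v ∧ t.2 = ⊤)})
    (hsep : ∀ t, P t → t.2 ≠ ⊤ → t.1 ≠ ⊥ → u ∈ H') :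
    LambdaIdeals K E ≃o {t : T × T' // P t} :=
  lambdaIdealsIso (g := fun t => D.gen t.1 ⊔ D'.gen t.2) (f := fun I => (D.inv I, D'.inv I))
    (fun t I => by rw [sup_le_iff, D.gc, D'.gc, Prod.le_def]) P (fun I _ => hP I)
    (by
      intro t ht
      obtain ⟨S, h1, h2⟩ := D.exists_gen_eq t.1
      obtain ⟨S', h1', h2'⟩ := D'.exists_gen_eq t.2
      refine ⟨S ∪ S', _, ?_, (hher t ht).1, (hher t ht).2, ?_⟩
      · rintro x (hx | hx)
        exacts [h1 x hx, h1' x hx]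
      · rw [h2, h2']
        apply le_antisymm
        · refine sup_le (TwoSidedIdeal.span_mono ?_) (TwoSidedIdeal.span_mono ?_)
          · rintro x (hx | ⟨rfl, hx⟩)
            exacts [.inl (.inl hx), .inr ⟨u, .inl ⟨rfl, hx⟩, rfl⟩]
          · rintro x (hx | ⟨rfl, hx⟩)
            exacts [.inl (.inr hx), .inr ⟨v, .inr ⟨rfl, hx⟩, rfl⟩]
        · rw [TwoSidedIdeal.span_le]
          rintro x ((hx | hx) | ⟨_, ⟨rfl, hx⟩ | ⟨rfl, hx⟩, rfl⟩)
          · exact TwoSidedIdeal.mem_sup_left (TwoSidedIdeal.subset_span (.inl hx))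
          · exact TwoSidedIdeal.mem_sup_right (TwoSidedIdeal.subset_span (.inl hx))
          · exact TwoSidedIdeal.mem_sup_left (TwoSidedIdeal.subset_span (.inr ⟨rfl, hx⟩))
          · exact TwoSidedIdeal.mem_sup_right (TwoSidedIdeal.subset_span (.inr ⟨rfl, hx⟩)))
    (by
      intro t ht
      refine ⟨D.inv_sup_le _ fun _ I hI => D'.gen_le_of_vert_mem (hI v rfl) _, ?_⟩
      change D'.inv (D.gen t.1 ⊔ D'.gen t.2) ≤ t.2
      rw [sup_comm]
      -- Either the contribution of `u` is zero, or `hsep` puts `u` into `H'`, so that the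
      -- separating ideal absorbs it.
      refine D'.inv_sup_le _ fun htop I hI => ?_
      by_cases hbot : t.1 = ⊥
      · rw [hbot, D.gc.l_bot]
        exact bot_le
      · exact D.gen_le_of_vert_mem (hI u (hsep t ht htop hbot)) _)
    (by
      rintro I ⟨S, X, hS, -, -, hI⟩
      have hsub : S ∪ (fun v => lpaGen K E (.vert v)) '' X ⊆ I := by
        rw [hI]
        exact TwoSidedIdeal.subset_span
      -- Only the left side becomes a span: its generators lie in `I`, and the invariants on the
      -- right are still those of `I`.
      conv_lhs => rw [hI]
      rw [TwoSidedIdeal.span_le]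
      rintro x (hx | ⟨z, hz, rfl⟩)
      · have hxI := hsub (.inl hx)
        obtain ⟨z, l, p, hl, -, -, rfl⟩ := hS x hx
        rcases hV z with rfl | rfl
        · exact TwoSidedIdeal.mem_sup_left (D.mem_gen_inv I l p hl hxI)
        · exact TwoSidedIdeal.mem_sup_right (D'.mem_gen_inv I l p hl hxI)
      · have hzI := hsub (.inr ⟨z, hz, rfl⟩)
        rcases hV z with rfl | rfl
        · exact TwoSidedIdeal.mem_sup_left (D.vert_mem_gen_inv hzI)
        · exact TwoSidedIdeal.mem_sup_right (D'.vert_mem_gen_inv hzI))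

/-- Two vertices without edges between them. -/
def disjointIso (hV : ∀ x, x = u ∨ x = v) (hE : ∀ e, E.r e = E.s e)
    (D : VertexInvariant K E u {v} T) (D' : VertexInvariant K E v {u} T') :
    LambdaIdeals K E ≃o T × T' :=
  (pairIso hV D D' (fun _ => True) (fun _ => trivial)
    (fun _ _ => ⟨isHereditary_iff.2 fun e he => (hE e).symm ▸ he,
      isSaturated_of_loops (fun e => ⟨e, rfl, hE e⟩) _⟩)
    (fun _ _ _ _ => rfl)).trans
  { toFun := Subtype.val
    invFun := fun t => ⟨t, trivial⟩
    left_inv := fun _ => rfl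
    right_inv := fun _ => rfl
    map_rel_iff' := Iff.rfl }

/-- The ordered sum of `T'` and `T` with the top of `T'` and the bottom of `T` identified. -/
abbrev Glue (T T' : Type*) [PartialOrder T] [BoundedOrder T] [PartialOrder T'] [BoundedOrder T'] :
    Type _ :=
  {t : T × T' // t.1 ≠ ⊥ → t.2 = ⊤}

/-- Two vertices `u`, `v` with edges from `u` to `v`, no edges from `v` to `u` and a loop at `u`. -/
def glueIso [Nontrivial T] (hV : ∀ x, x = u ∨ x = v) (hv : ∀ e, E.s e = v → E.r e = v)
    (hu : ∃ e, E.s e = u ∧ E.r e = u) (D : VertexInvariant K E u {v} T)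
    (D' : VertexInvariant K E v ∅ T') (hD : ∀ I, D.inv I ≠ ⊥ → lpaGen K E (.vert v) ∈ I) :
    LambdaIdeals K E ≃o Glue T T' :=
  pairIso hV D D' (fun t => t.1 ≠ ⊥ → t.2 = ⊤) (fun I hI => D'.inv_eq_top_iff.2 (hD I hI))
    (by
      intro t ht
      refine ⟨isHereditary_iff.2 ?_, isSaturated_of_loops (fun e => ?_) _⟩
      · rintro e (⟨-, h2⟩ | ⟨h1, h2⟩)
        · have h3 : t.2 = ⊤ := ht (by rw [h2]; exact top_ne_bot)
          rcases hV (E.r e) with h | h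
          exacts [.inl ⟨h, h2⟩, .inr ⟨h, h3⟩]
        · exact .inr ⟨hv e h1, h2⟩
      · rcases hV (E.s e) with h | h
        · rw [h]
          exact hu
        · exact ⟨e, rfl, (hv e h).trans h.symm⟩)
    (fun t ht h h' => absurd (ht h') h)

/-- Two vertices that generate the same ideal. -/
def singleIso (hV : ∀ x, x = u ∨ x = v) (D : VertexInvariant K E v ∅ T)
    (huv : ∀ I : TwoSidedIdeal (LeavittPathAlgebra K E),
      lpaGen K E (.vert u) ∈ I ↔ lpaGen K E (.vert v) ∈ I)
    (hu : ∀ I l p, E.IsK1Cycle l u → lpaPolyAt K E u l p ∈ I →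
      lpaPolyAt K E u l p ∈ D.gen (D.inv I)) :
    LambdaIdeals K E ≃o T :=
  (lambdaIdealsIso D.gc (fun _ => True) (fun _ _ => trivial)
    (by
      intro t _
      by_cases ht : t = ⊤
      · refine ⟨∅, Set.univ, by simp, isHereditary_univ, isSaturated_univ, ?_⟩
        have hv : lpaGen K E (.vert v) ∈ D.gen t := by
          rw [ht, D.gen_top]
          exact TwoSidedIdeal.subset_span rfl
        rw [eq_top_of_forall_vert_mem (I := D.gen t), eq_comm]
        · refine eq_top_of_forall_vert_mem fun z => TwoSidedIdeal.subset_span ?_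
          exact .inr ⟨z, trivial, rfl⟩
        · intro z
          rcases hV z with rfl | rfl
          exacts [(huv _).2 hv, hv]
      · obtain ⟨S, h1, h2⟩ := D.gen_of_ne_top t ht
        exact ⟨S, ∅, h1, isHereditary_empty, isSaturated_empty, by simp [h2]⟩)
    (fun t _ => by simpa using D.inv_sup_le t (J := ⊥) fun _ _ _ => bot_le)
    (by
      rintro I ⟨S, X, hS, -, -, hI⟩
      have hsub : S ∪ (fun v => lpaGen K E (.vert v)) '' X ⊆ I := by
        rw [hI]
        exact TwoSidedIdeal.subset_span
      conv_lhs => rw [hI]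
      rw [TwoSidedIdeal.span_le]
      rintro x (hx | ⟨z, hz, rfl⟩)
      · have hxI := hsub (.inl hx)
        obtain ⟨z, l, p, hl, -, -, rfl⟩ := hS x hx
        rcases hV z with rfl | rfl
        exacts [hu I l p hl hxI, D.mem_gen_inv I l p hl hxI]
      · have hzI := hsub (.inr ⟨z, hz, rfl⟩)
        rcases hV z with rfl | rfl
        exacts [(huv _).2 (D.vert_mem_gen_inv ((huv _).1 hzI)), D.vert_mem_gen_inv hzI])).trans
  { toFun := Subtype.val
    invFun := fun t => ⟨t, trivial⟩
    left_inv := fun _ => rfl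
    right_inv := fun _ => rfl
    map_rel_iff' := Iff.rfl }

end

section NoReturn

theorem exists_propInvariant (hH : E.IsHereditary H) (hH' : E.IsSaturated H) (hw : w ∉ H)
    (hret : E.NoReturn w) (hl : ¬ E.HasUniqueLoop w) :
    ∃ D : VertexInvariant K E w H Prop, ∀ I, D.inv I ≠ ⊥ → ∀ f, E.s f = w → E.r f ≠ w →
      lpaGen K E (.vert (E.r f)) ∈ I := by
  refine ⟨propInvariant hH hH' hw (not_isK1Cycle_of_noReturn hret hl), fun I hI f hf _ => ?_⟩
  have h1 : lpaGen K E (.vert w) ∈ I := by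
    by_contra h
    exact hI (eq_false h)
  exact range_mem (hf.symm ▸ h1)

/-- The unique loop is the K1 cycle, and `hout` makes it isolated. A nonzero value contains a
polynomial with nonzero constant term, which forces the ranges of the other edges into `I`; gluing
relies on that last clause. -/
theorem exists_polyInvariant (hH : E.IsHereditary H) (hH' : E.IsSaturated H) (hw : w ∉ H)
    (hret : E.NoReturn w) (hout : ∀ e, E.s e = w → E.r e ∉ H → E.r e = w)
    (hl : E.HasUniqueLoop w) :
    ∃ D : VertexInvariant K E w H (XSatIdeal K), ∀ I, D.inv I ≠ ⊥ →
      ∀ f, E.s f = w → E.r f ≠ w → lpaGen K E (.vert (E.r f)) ∈ I := by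
  obtain ⟨e, he, he', huniq⟩ := hl
  have hK : E.IsK1Cycle [e] w := (isK1Cycle_iff_of_no_return hret).2 ⟨e, rfl, he, he', huniq⟩
  have hi : Isolated E H [e] := by
    intro f hf
    obtain rfl : f = e := by simpa using hf
    refine ⟨he' ▸ hw, fun g hg hg' => ?_⟩
    rw [he] at hg
    exact huniq g hg (hout g hg hg')
  refine ⟨polyInvariant hH hH' hK hi, fun I hI f hf hfw => ?_⟩
  obtain ⟨g, hg, h0⟩ := XSatIdeal.exists_coeff_zero_ne hI
  refine range_mem_of_lpaPolyAt_mem hf (fun h => hfw (h ▸ he')) h0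
    ((mem_polyIdeal hK.1.1.1).1 ?_)
  exact hg ▸ Ideal.mem_span_singleton_self g

end NoReturn

section TwoCycle

/-- On monomials this is `(ab)^n a = a (ba)^n`. -/
theorem aeval_mul_comm {B : Type*} [Ring B] [Algebra K B] (a b : B) (p : K[X]) :
    aeval (a * b) p * a = a * aeval (b * a) p := by
  induction p using Polynomial.induction_on' with
  | add p q hp hq => rw [map_add, map_add, mul_add, add_mul, hp, hq]
  | monomial n c =>
    have h : ∀ n : ℕ, (a * b) ^ n * a = a * (b * a) ^ n := fun n => by
      induction n with
      | zero => simp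
      | succ n ih => rw [pow_succ', mul_assoc, ih, pow_succ']; simp only [mul_assoc]
    rw [aeval_monomial, aeval_monomial, mul_assoc, h, ← mul_assoc, ← mul_assoc,
      Algebra.commutes]

/-- Conjugation by `f` rotates the cycle. Thus a polynomial in the 2-cycle at `u` generates the same
ideal as the same polynomial in the 2-cycle at `v`, and the invariant at `v` suffices. -/
theorem ghost_mul_lpaPolyAt_mul_edge {e f : Ed} (hf : E.s f = v) (hf' : E.r f = u) (p : K[X]) :
    lpaGen K E (.ghost f) * lpaPolyAt K E v [f, e] p * lpaGen K E (.edge f) =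
      lpaPolyAt K E u [e, f] p := by
  rw [lpaPolyAt, lpaPolyAt, lpaPath_cons f [e], lpaPath_cons e [f], lpaPath_singleton, lpaPath_singleton,
    ← mul_assoc, ← hf, ghost_mul_source, mul_assoc, aeval_mul_comm, ← mul_assoc, ghost_mul_edge,
    hf']

/-- Edges `e` from `u` to `v` and `f` from `v` to `u`, and no others. -/
theorem exists_iso_of_two_cycle (hV : ∀ x, x = u ∨ x = v) (huv : u ≠ v) {e f : Ed}
    (he : E.s e = u) (he' : E.r e = v) (hf : E.s f = v) (hf' : E.r f = u)
    (h : ∀ g, g = e ∨ g = f) : Nonempty (LambdaIdeals K E ≃o XSatIdeal K) := by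
  have hK := isK1Cycle_pair he he' hf hf' huv h
  have hK' := isK1Cycle_pair hf hf' he he' huv.symm fun g => (h g).symm
  have hs : ∀ {a b : Ed}, E.s a = E.s b → a = b := by
    intro a b hab
    rcases h a with rfl | rfl <;> rcases h b with rfl | rfl
    · rfl
    · exact absurd (he.symm.trans (hab.trans hf)) huv
    · exact absurd (he.symm.trans (hab.symm.trans hf)) huv
    · rfl
  refine ⟨singleIso hV (polyInvariant isHereditary_empty isSaturated_empty hK
    fun a _ => ⟨fun h => h, fun b hb _ => hs hb⟩) (fun I => ⟨fun hI => ?_, fun hI => ?_⟩) ?_⟩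
  · exact he' ▸ range_mem (he.symm ▸ hI)
  · exact hf' ▸ range_mem (hf.symm ▸ hI)
  · intro I l p hl hp
    obtain rfl := hK'.2 l hl.1.1
    rw [← ghost_mul_lpaPolyAt_mul_edge hf hf']
    refine TwoSidedIdeal.mul_mem_right _ _ _ (TwoSidedIdeal.mul_mem_left _ _ _ ?_)
    refine VertexInvariant.mem_gen_inv _ I _ p hK ?_
    rw [← ghost_mul_lpaPolyAt_mul_edge he he']
    exact I.mul_mem_right _ _ (I.mul_mem_left _ _ hp)

/-- Edges in both directions, and at least one further edge. -/
theorem exists_iso_of_strongly_connected (hV : ∀ x, x = u ∨ x = v) (huv : u ≠ v) {e f g : Ed}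
    (he : E.s e = u) (he' : E.r e = v) (hf : E.s f = v) (hf' : E.r f = u) (hge : g ≠ e)
    (hgf : g ≠ f) : Nonempty (LambdaIdeals K E ≃o Prop) := by
  refine ⟨singleIso hV (propInvariant isHereditary_empty isSaturated_empty (fun h => h)
    (not_isK1Cycle_of_three_edges hV he he' hf hf' huv hge hgf))
    (fun I => ⟨fun hI => ?_, fun hI => ?_⟩) ?_⟩
  · exact he' ▸ range_mem (he.symm ▸ hI)
  · exact hf' ▸ range_mem (hf.symm ▸ hI)
  · intro I l p hl _
    exact absurd hl (not_isK1Cycle_of_three_edges (fun x => (hV x).symm) hf hf' he he' huv.symm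
      hgf hge l)

end TwoCycle

section OneWay

variable {T : Type*} [PartialOrder T] [BoundedOrder T]

/-- All edges at `u` lead to `v`, and there are no edges from `v` to `u`. -/
def iso_of_source (hV : ∀ x, x = u ∨ x = v) (huv : u ≠ v) (hv : ∀ e, E.s e = v → E.r e = v)
    (hu : ∀ e, E.s e = u → E.r e = v) (hne : ∃ e, E.s e = u) (D : VertexInvariant K E v ∅ T) :
    LambdaIdeals K E ≃o T :=
  singleIso hV D
    (fun I => ⟨fun hI => by
      obtain ⟨e, he⟩ := hne
      exact hu e he ▸ range_mem (he.symm ▸ hI),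
      fun hI => vert_mem_of_range_mem hne fun e he => (hu e he).symm ▸ hI⟩)
    (fun I l p hl _ => by
      obtain ⟨e, -, he, he', -⟩ :=
        (isK1Cycle_iff_of_no_return (noReturn_of_hereditary hV huv hv)).1 hl
      exact absurd (he'.symm.trans (hu e he)) huv)

end OneWay

end Leavitt

/-! ### Normal forms of the glued orders -/

namespace Leavitt

open DirGraph

section Order

variable {T A : Type*} [PartialOrder T] [BoundedOrder T] [PartialOrder A] [OrderBot A]

/-- Gluing at the top of `WithTop A` is the ordered sum with `A`. -/
noncomputable def glueWithTopIso : A ⊕ₗ T ≃o Glue T (WithTop A) :=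
  let f : A ⊕ₗ T → Glue T (WithTop A) := fun x => Sum.elim
    (fun a : A => ⟨(⊥, (a : WithTop A)), fun h => absurd rfl h⟩) (fun t : T => ⟨(t, ⊤), fun _ => rfl⟩)
    (ofLex x)
  RelIso.ofSurjective
    (OrderEmbedding.ofMapLEIff f (by
      intro x y
      change (f x).1 ≤ (f y).1 ↔ x ≤ y
      rcases x with a | t <;> rcases y with b | t'
      · change ((⊥ : T), (a : WithTop A)) ≤ (⊥, (b : WithTop A)) ↔ _
        rw [Prod.mk_le_mk, WithTop.coe_le_coe]
        exact ⟨fun h => Sum.Lex.inl_le_inl_iff.2 h.2,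
          fun h => ⟨le_rfl, Sum.Lex.inl_le_inl_iff.1 h⟩⟩
      · change ((⊥ : T), (a : WithTop A)) ≤ (t', ⊤) ↔ _
        exact ⟨fun _ => Sum.Lex.inl_le_inr a t', fun _ => ⟨bot_le, le_top⟩⟩
      · change (t, (⊤ : WithTop A)) ≤ (⊥, (b : WithTop A)) ↔ _
        rw [Prod.mk_le_mk]
        exact ⟨fun h => absurd (top_le_iff.1 h.2) WithTop.coe_ne_top,
          fun h => absurd h Sum.Lex.not_inr_le_inl⟩
      · change (t, (⊤ : WithTop A)) ≤ (t', ⊤) ↔ _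
        rw [Prod.mk_le_mk]
        exact ⟨fun h => Sum.Lex.inr_le_inr_iff.2 h.1,
          fun h => ⟨Sum.Lex.inr_le_inr_iff.1 h, le_rfl⟩⟩))
    (by
      rintro ⟨⟨t, a⟩, h⟩
      induction a using WithTop.recTopCoe with
      | top => exact ⟨toLex (.inr t), rfl⟩
      | coe a =>
        have ht : t = ⊥ := by
          by_contra h'
          exact WithTop.coe_ne_top (h h')
        subst ht
        exact ⟨toLex (.inl a), rfl⟩)

/-- Adding a top and a bottom element commute. -/
noncomputable def withTopWithBotIso (α : Type*) [PartialOrder α] :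
    WithTop (WithBot α) ≃o WithBot (WithTop α) :=
  WithTop.orderIsoSumLexPUnit.{_, 0}.trans <|
  (OrderIso.sumLexCongr WithBot.orderIsoPUnitSumLex.{_, 0} (OrderIso.refl _)).trans <|
  (OrderIso.sumLexAssoc _ _ _).trans <|
  (OrderIso.sumLexCongr (OrderIso.refl _) WithTop.orderIsoSumLexPUnit.{_, 0}.symm).trans
  WithBot.orderIsoPUnitSumLex.{_, 0}.symm

noncomputable def propIso : Prop ≃o Fin 2 :=
  (Fintype.orderIsoFinOfCardEq Prop Fintype.card_prop).symm

/-- Presents the two-element order as `WithTop A`, the shape of lower part that `glueWithTopIso`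
expects. -/
noncomputable def withTopPUnitIso : WithTop PUnit.{1} ≃o Fin 2 :=
  (Fintype.orderIsoFinOfCardEq (WithTop PUnit.{1}) (by rfl)).symm

noncomputable def withBotFinTwoIso : WithBot (Fin 2) ≃o Fin 3 :=
  (Fintype.orderIsoFinOfCardEq (WithBot (Fin 2)) (by rfl)).symm

noncomputable def glueFinFinIso : Glue (Fin 2) (WithTop PUnit.{1}) ≃o Fin 3 :=
  glueWithTopIso.symm.trans (WithBot.orderIsoPUnitSumLex.{_, 0}.symm.trans withBotFinTwoIso)

noncomputable def glueFinIso : Glue T (WithTop PUnit.{1}) ≃o WithBot T :=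
  glueWithTopIso.symm.trans WithBot.orderIsoPUnitSumLex.{_, 0}.symm

noncomputable def glueWithBotIso (α : Type*) [PartialOrder α] :
    Glue T (WithTop (WithBot α)) ≃o WithBot (α ⊕ₗ T) :=
  glueWithTopIso.symm.trans <|
  (OrderIso.sumLexCongr WithBot.orderIsoPUnitSumLex.{_, 0} (OrderIso.refl _)).trans <|
  (OrderIso.sumLexAssoc _ _ _).trans WithBot.orderIsoPUnitSumLex.{_, 0}.symm

/-- The bottom of `Fin 2` is identified with the top of the lower part, so the gluing merely adds
one new top. -/
noncomputable def glueWithBotFinIso (α : Type*) [PartialOrder α] :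
    Glue (Fin 2) (WithTop (WithBot α)) ≃o WithTop (WithBot (WithTop α)) :=
  glueWithTopIso.symm.trans <|
  (OrderIso.sumLexCongr (OrderIso.refl _) (withTopPUnitIso.symm.trans
    WithTop.orderIsoSumLexPUnit.{_, 0})).trans <|
  (OrderIso.sumLexAssoc _ _ _).symm.trans <|
  (OrderIso.sumLexCongr WithTop.orderIsoSumLexPUnit.{_, 0}.symm (OrderIso.refl _)).trans <|
  WithTop.orderIsoSumLexPUnit.{_, 0}.symm.trans (withTopWithBotIso α).withTopCongr

end Order

/-! ### Type of a graph from its loops and connecting edges -/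

section OneWay

variable {V Ed : Type*} {E : DirGraph V Ed} {u v : V}

/-- There are only the vertices `u` and `v`, edges from `u` to `v`, and no edges back. -/
structure OneWay (E : DirGraph V Ed) (u v : V) : Prop where
  eq_or_eq : ∀ x, x = u ∨ x = v
  ne : u ≠ v
  range_eq : ∀ e, E.s e = v → E.r e = v
  exists_edge : ∃ e, E.s e = u ∧ E.r e = v

namespace OneWay

theorem isHereditary (h : OneWay E u v) : E.IsHereditary {v} :=
  isHereditary_iff.2 fun e he => h.range_eq e he

theorem exists_loop (h : OneWay E u v) (hl : ∃ e, E.s e = u ∧ E.r e = u) (e : Ed) :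
    ∃ f, E.s f = E.s e ∧ E.r f = E.s e := by
  rcases h.eq_or_eq (E.s e) with he | he
  · rwa [he]
  · exact ⟨e, rfl, (h.range_eq e he).trans he.symm⟩

theorem range_eq_of_no_loop (h : OneWay E u v) (hl : ¬ ∃ e, E.s e = u ∧ E.r e = u) (e : Ed)
    (he : E.s e = u) : E.r e = v :=
  (h.eq_or_eq _).resolve_left fun he' => hl ⟨e, he, he'⟩

theorem exists_source_eq (h : OneWay E u v) : ∃ e, E.s e = u :=
  let ⟨e, he, _⟩ := h.exists_edge
  ⟨e, he⟩

end OneWay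

end OneWay

section Types

variable {K : Type*} [Field K] {V Ed : Type*} [Fintype V] [DecidableEq V] [Fintype Ed]
  {E : DirGraph V Ed} {u v : V}

theorem exists_finInvariant_of_disjoint (huv : u ≠ v) (hE : ∀ e, E.r e = E.s e)
    (hl : ¬ E.HasUniqueLoop u) : Nonempty (VertexInvariant K E u {v} (Fin 2)) := by
  obtain ⟨D, -⟩ := exists_propInvariant (K := K) (H := {v})
    (isHereditary_iff.2 fun e he => (hE e).symm ▸ he)
    (isSaturated_of_loops (fun e => ⟨e, rfl, hE e⟩) _) huv
    (noReturn_of_forall_loop fun e he => (hE e).trans he) hl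
  exact ⟨D.congr propIso⟩

theorem exists_familyInvariant_of_disjoint (huv : u ≠ v) (hE : ∀ e, E.r e = E.s e)
    (hl : E.HasUniqueLoop u) : Nonempty (VertexInvariant K E u {v} (BoundedFamily K)) := by
  obtain ⟨D, -⟩ := exists_polyInvariant (K := K) (H := {v})
    (isHereditary_iff.2 fun e he => (hE e).symm ▸ he)
    (isSaturated_of_loops (fun e => ⟨e, rfl, hE e⟩) _) huv
    (noReturn_of_forall_loop fun e he => (hE e).trans he) (fun e he _ => (hE e).trans he) hl
  exact ⟨D.congr XSatIdeal.boundedFamilyIso.symm⟩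

theorem hasType_VII (hV : ∀ x, x = u ∨ x = v) (huv : u ≠ v) (hE : ∀ e, E.r e = E.s e)
    (hu : ¬ E.HasUniqueLoop u) (hv : ¬ E.HasUniqueLoop v) :
    HasLatticeType K (LambdaIdeals K E) .VII := by
  obtain ⟨D⟩ := exists_finInvariant_of_disjoint (K := K) huv hE hu
  obtain ⟨D'⟩ := exists_finInvariant_of_disjoint (K := K) huv.symm hE hv
  exact ⟨disjointIso hV hE D D'⟩

theorem hasType_VIII (hV : ∀ x, x = u ∨ x = v) (huv : u ≠ v) (hE : ∀ e, E.r e = E.s e)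
    (hu : E.HasUniqueLoop u) (hv : ¬ E.HasUniqueLoop v) :
    HasLatticeType K (LambdaIdeals K E) .VIII := by
  obtain ⟨D⟩ := exists_familyInvariant_of_disjoint (K := K) huv hE hu
  obtain ⟨D'⟩ := exists_finInvariant_of_disjoint (K := K) huv.symm hE hv
  exact ⟨disjointIso hV hE D D'⟩

theorem hasType_IX (hV : ∀ x, x = u ∨ x = v) (huv : u ≠ v) (hE : ∀ e, E.r e = E.s e)
    (hu : E.HasUniqueLoop u) (hv : E.HasUniqueLoop v) :
    HasLatticeType K (LambdaIdeals K E) .IX := by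
  obtain ⟨D⟩ := exists_familyInvariant_of_disjoint (K := K) huv hE hu
  obtain ⟨D'⟩ := exists_familyInvariant_of_disjoint (K := K) huv.symm hE hv
  exact ⟨disjointIso hV hE D D'⟩

namespace OneWay

theorem exists_lower_fin (h : OneWay E u v) (hv : ¬ E.HasUniqueLoop v) :
    Nonempty (VertexInvariant K E v ∅ (Fin 2)) := by
  obtain ⟨D, -⟩ := exists_propInvariant (K := K) (E := E) isHereditary_empty isSaturated_empty
    (Set.notMem_empty v) (noReturn_of_forall_loop h.range_eq) hv
  exact ⟨D.congr propIso⟩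

theorem exists_lower_family (h : OneWay E u v) (hv : E.HasUniqueLoop v) :
    Nonempty (VertexInvariant K E v ∅ (BoundedFamily K)) := by
  obtain ⟨D, -⟩ := exists_polyInvariant (K := K) (E := E) isHereditary_empty isSaturated_empty
    (Set.notMem_empty v) (noReturn_of_forall_loop h.range_eq) (fun e he _ => h.range_eq e he) hv
  exact ⟨D.congr XSatIdeal.boundedFamilyIso.symm⟩

theorem exists_upper_fin (h : OneWay E u v) (hl : ∃ e, E.s e = u ∧ E.r e = u)
    (hu : ¬ E.HasUniqueLoop u) : ∃ D : VertexInvariant K E u {v} (Fin 2),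
      ∀ I, D.inv I ≠ ⊥ → lpaGen K E (.vert v) ∈ I := by
  obtain ⟨D, hD⟩ := exists_propInvariant (K := K) h.isHereditary
    (isSaturated_of_loops (h.exists_loop hl) _) h.ne
    (noReturn_of_hereditary h.eq_or_eq h.ne h.range_eq) hu
  refine ⟨D.congr propIso, fun I hI => ?_⟩
  obtain ⟨f, hf, hf'⟩ := h.exists_edge
  exact hf' ▸ hD I (fun h0 => hI ((congrArg propIso h0).trans (map_bot propIso))) f hf
    (hf' ▸ h.ne.symm)

theorem exists_upper_family (h : OneWay E u v) (hu : E.HasUniqueLoop u) :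
    ∃ D : VertexInvariant K E u {v} (BoundedFamily K),
      ∀ I, D.inv I ≠ ⊥ → lpaGen K E (.vert v) ∈ I := by
  have hl : ∃ e, E.s e = u ∧ E.r e = u := by
    obtain ⟨e, he, he', -⟩ := hu
    exact ⟨e, he, he'⟩
  obtain ⟨D, hD⟩ := exists_polyInvariant (K := K) h.isHereditary
    (isSaturated_of_loops (h.exists_loop hl) _) h.ne
    (noReturn_of_hereditary h.eq_or_eq h.ne h.range_eq)
    (fun e _ he => (h.eq_or_eq _).resolve_right he) hu
  refine ⟨D.congr XSatIdeal.boundedFamilyIso.symm, fun I hI => ?_⟩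
  obtain ⟨f, hf, hf'⟩ := h.exists_edge
  exact hf' ▸ hD I (fun h0 => hI ((congrArg _ h0).trans
    (map_bot XSatIdeal.boundedFamilyIso.symm))) f hf (hf' ▸ h.ne.symm)

theorem hasType_I (h : OneWay E u v) (hl : ¬ ∃ e, E.s e = u ∧ E.r e = u)
    (hv : ¬ E.HasUniqueLoop v) : HasLatticeType K (LambdaIdeals K E) .I := by
  obtain ⟨D⟩ := h.exists_lower_fin (K := K) hv
  exact ⟨iso_of_source h.eq_or_eq h.ne h.range_eq (h.range_eq_of_no_loop hl)
    h.exists_source_eq D⟩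

theorem hasType_II (h : OneWay E u v) (hl : ¬ ∃ e, E.s e = u ∧ E.r e = u)
    (hv : E.HasUniqueLoop v) : HasLatticeType K (LambdaIdeals K E) .II := by
  obtain ⟨D⟩ := h.exists_lower_family (K := K) hv
  exact ⟨iso_of_source h.eq_or_eq h.ne h.range_eq (h.range_eq_of_no_loop hl)
    h.exists_source_eq D⟩

theorem hasType_III (h : OneWay E u v) (hu : E.HasUniqueLoop u) (hv : ¬ E.HasUniqueLoop v) :
    HasLatticeType K (LambdaIdeals K E) .III := by
  obtain ⟨D, hD⟩ := h.exists_upper_family (K := K) hu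
  obtain ⟨D'⟩ := h.exists_lower_fin (K := K) hv
  obtain ⟨e, he, he', -⟩ := hu
  exact ⟨(glueIso h.eq_or_eq h.range_eq ⟨e, he, he'⟩ D (D'.congr withTopPUnitIso.symm) hD).trans
    glueFinIso⟩

theorem hasType_IV (h : OneWay E u v) (hu : E.HasUniqueLoop u) (hv : E.HasUniqueLoop v) :
    HasLatticeType K (LambdaIdeals K E) .IV := by
  obtain ⟨D, hD⟩ := h.exists_upper_family (K := K) hu
  obtain ⟨D'⟩ := h.exists_lower_family (K := K) hv
  obtain ⟨e, he, he', -⟩ := hu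
  exact ⟨(glueIso h.eq_or_eq h.range_eq ⟨e, he, he'⟩ D (D'.congr (withTopWithBotIso _).symm)
    hD).trans (glueWithBotIso _)⟩

theorem hasType_V (h : OneWay E u v) (hl : ∃ e, E.s e = u ∧ E.r e = u)
    (hu : ¬ E.HasUniqueLoop u) (hv : ¬ E.HasUniqueLoop v) :
    HasLatticeType K (LambdaIdeals K E) .V := by
  obtain ⟨D, hD⟩ := h.exists_upper_fin (K := K) hl hu
  obtain ⟨D'⟩ := h.exists_lower_fin (K := K) hv
  exact ⟨(glueIso h.eq_or_eq h.range_eq hl D (D'.congr withTopPUnitIso.symm) hD).trans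
    glueFinFinIso⟩

theorem hasType_VI (h : OneWay E u v) (hl : ∃ e, E.s e = u ∧ E.r e = u)
    (hu : ¬ E.HasUniqueLoop u) (hv : E.HasUniqueLoop v) :
    HasLatticeType K (LambdaIdeals K E) .VI := by
  obtain ⟨D, hD⟩ := h.exists_upper_fin (K := K) hl hu
  obtain ⟨D'⟩ := h.exists_lower_family (K := K) hv
  exact ⟨(glueIso h.eq_or_eq h.range_eq hl D (D'.congr (withTopWithBotIso _).symm) hD).trans
    (glueWithBotFinIso _)⟩

theorem exists_hasType (h : OneWay E u v) : ∃ t, HasLatticeType K (LambdaIdeals K E) t := by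
  by_cases hl : ∃ e, E.s e = u ∧ E.r e = u
  · by_cases hu : E.HasUniqueLoop u <;> by_cases hv : E.HasUniqueLoop v
    exacts [⟨_, h.hasType_IV hu hv⟩, ⟨_, h.hasType_III hu hv⟩, ⟨_, h.hasType_VI hl hu hv⟩,
      ⟨_, h.hasType_V hl hu hv⟩]
  · by_cases hv : E.HasUniqueLoop v
    exacts [⟨_, h.hasType_II hl hv⟩, ⟨_, h.hasType_I hl hv⟩]

end OneWay

theorem hasType_II_of_two_cycle (hV : ∀ x, x = u ∨ x = v) (huv : u ≠ v) {e f : Ed}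
    (he : E.s e = u) (he' : E.r e = v) (hf : E.s f = v) (hf' : E.r f = u)
    (h : ∀ g, g = e ∨ g = f) : HasLatticeType K (LambdaIdeals K E) .II := by
  obtain ⟨φ⟩ := exists_iso_of_two_cycle (K := K) hV huv he he' hf hf' h
  exact ⟨φ.trans XSatIdeal.boundedFamilyIso.symm⟩

theorem hasType_I_of_strongly_connected (hV : ∀ x, x = u ∨ x = v) (huv : u ≠ v) {e f g : Ed}
    (he : E.s e = u) (he' : E.r e = v) (hf : E.s f = v) (hf' : E.r f = u) (hge : g ≠ e)
    (hgf : g ≠ f) : HasLatticeType K (LambdaIdeals K E) .I := by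
  obtain ⟨φ⟩ := exists_iso_of_strongly_connected (K := K) hV huv he he' hf hf' hge hgf
  exact ⟨φ.trans propIso⟩

theorem exists_hasLatticeType (hcard : Fintype.card V = 2) :
    ∃ t, HasLatticeType K (LambdaIdeals K E) t := by
  obtain ⟨u, v, huv, hV⟩ : ∃ u v : V, u ≠ v ∧ ∀ x, x = u ∨ x = v := by
    obtain ⟨u, v, huv, h⟩ := Finset.card_eq_two.1 (Finset.card_univ.trans hcard)
    exact ⟨u, v, huv, fun x => by simpa [h] using Finset.mem_univ x⟩
  by_cases h1 : ∃ e, E.s e = u ∧ E.r e = v <;> by_cases h2 : ∃ e, E.s e = v ∧ E.r e = u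
  · obtain ⟨e, he, he'⟩ := h1
    obtain ⟨f, hf, hf'⟩ := h2
    by_cases h : ∀ g, g = e ∨ g = f
    · exact ⟨_, hasType_II_of_two_cycle hV huv he he' hf hf' h⟩
    · push Not at h
      obtain ⟨g, hge, hgf⟩ := h
      exact ⟨_, hasType_I_of_strongly_connected hV huv he he' hf hf' hge hgf⟩
  · exact OneWay.exists_hasType ⟨hV, huv, fun e he => (hV _).resolve_left
      fun he' => h2 ⟨e, he, he'⟩, h1⟩
  · exact OneWay.exists_hasType ⟨fun x => (hV x).symm, huv.symm, fun e he => (hV _).resolve_right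
      fun he' => h1 ⟨e, he, he'⟩, h2⟩
  · have hE : ∀ e, E.r e = E.s e := by
      intro e
      rcases hV (E.s e) with he | he <;> rcases hV (E.r e) with he' | he'
      · rw [he, he']
      · exact absurd ⟨e, he, he'⟩ h1
      · exact absurd ⟨e, he, he'⟩ h2
      · rw [he, he']
    by_cases hu : E.HasUniqueLoop u <;> by_cases hv : E.HasUniqueLoop v
    exacts [⟨_, hasType_IX hV huv hE hu hv⟩, ⟨_, hasType_VIII hV huv hE hu hv⟩,
      ⟨_, hasType_VIII (fun x => (hV x).symm) huv.symm hE hv hu⟩, ⟨_, hasType_VII hV huv hE hu hv⟩]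

end Types

/-! ### The sixteen representative graphs -/

section Representatives

variable (K : Type*) [Field K]

instance {V Ed : Type*} [DecidableEq V] [DecidableEq Ed] [Fintype Ed] (E : DirGraph V Ed) (w : V) :
    Decidable (E.HasUniqueLoop w) :=
  inferInstanceAs (Decidable (∃ e, E.s e = w ∧ E.r e = w ∧ ∀ f, E.s f = w → E.r f = w → f = e))

theorem hasType_representative : ∀ x ∈ representativeTable, HasLatticeType K
    (LambdaIdeals K (twoVertexGraph x.1.1 x.1.2.1 x.1.2.2.1 x.1.2.2.2)) x.2 := by
  have hV : ∀ x : Fin 2, x = 0 ∨ x = 1 := by decide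
  have hV' : ∀ x : Fin 2, x = 1 ∨ x = 0 := by decide
  simp only [representativeTable, List.forall_mem_cons, List.not_mem_nil, false_imp_iff,
    implies_true, and_true]
  refine ⟨?_, ?_, ?_, ?_, ?_, ?_, ?_, ?_, ?_, ?_, ?_, ?_, ?_, ?_, ?_, ?_⟩
  · exact hasType_VII hV (by decide) (by decide) (by decide) (by decide)
  · exact OneWay.hasType_I ⟨hV, by decide, by decide, by decide⟩ (by decide) (by decide)
  · exact hasType_II_of_two_cycle hV (by decide) (e := .inr (.inl 0)) (f := .inr (.inr 0))
      rfl rfl rfl rfl (by decide)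
  · exact hasType_I_of_strongly_connected hV (by decide) (e := .inr (.inl 0))
      (f := .inr (.inr 0)) (g := .inr (.inl 1)) rfl rfl rfl rfl (by decide) (by decide)
  · exact hasType_VIII hV (by decide) (by decide) (by decide) (by decide)
  · exact OneWay.hasType_III ⟨hV, by decide, by decide, by decide⟩ (by decide) (by decide)
  · exact OneWay.hasType_II ⟨hV', by decide, by decide, by decide⟩ (by decide) (by decide)
  · exact hasType_I_of_strongly_connected hV (by decide) (e := .inr (.inl 0))
      (f := .inr (.inr 0)) (g := .inl (.inl 0)) rfl rfl rfl rfl (by decide) (by decide)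
  · exact hasType_IX hV (by decide) (by decide) (by decide) (by decide)
  · exact OneWay.hasType_IV ⟨hV, by decide, by decide, by decide⟩ (by decide) (by decide)
  · exact hasType_VII hV (by decide) (by decide) (by decide) (by decide)
  · exact OneWay.hasType_V ⟨hV, by decide, by decide, by decide⟩ (by decide) (by decide)
      (by decide)
  · exact OneWay.hasType_I ⟨hV', by decide, by decide, by decide⟩ (by decide) (by decide)
  · exact OneWay.hasType_VI ⟨hV, by decide, by decide, by decide⟩ (by decide) (by decide)
      (by decide)
  · exact OneWay.hasType_III ⟨hV', by decide, by decide, by decide⟩ (by decide) (by decide)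
  · exact OneWay.hasType_V ⟨hV, by decide, by decide, by decide⟩ (by decide) (by decide)
      (by decide)

end Representatives

end Leavitt

/-! ### Joins and meets in the nine types -/

namespace Leavitt

section Lattice

theorem exists_isLUB_isGLB {α β : Type*} [PartialOrder α] [Lattice β] (φ : α ≃o β) (a b : α) :
    (∃ M, IsLUB {a, b} M) ∧ ∃ N, IsGLB {a, b} N := by
  refine ⟨⟨φ.symm (φ a ⊔ φ b), ?_⟩, ⟨φ.symm (φ a ⊓ φ b), ?_⟩⟩
  · rw [← φ.isLUB_image, Set.image_pair]
    exact isLUB_pair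
  · rw [← φ.isGLB_image, Set.image_pair]
    exact isGLB_pair

/-- The gluing condition survives componentwise operations: a join with nonzero first component has
an argument with nonzero first component, and for a meet both arguments have one. -/
instance {T T' : Type*} [Lattice T] [BoundedOrder T] [Lattice T'] [BoundedOrder T'] :
    Lattice (Glue T T') :=
  Subtype.lattice
    (fun {x y} hx hy h => by
      by_cases hx' : x.1 = ⊥
      · have hy' : y.1 ≠ ⊥ := fun hy' => h (by rw [Prod.fst_sup, hx', hy', sup_bot_eq])
        rw [Prod.snd_sup, hy hy', sup_top_eq]
      · rw [Prod.snd_sup, hx hx', top_sup_eq])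
    (fun {x y} hx hy h => by
      have hx' : x.1 ≠ ⊥ := fun hx' => h (by rw [Prod.fst_inf, hx', bot_inf_eq])
      have hy' : y.1 ≠ ⊥ := fun hy' => h (by rw [Prod.fst_inf, hy', inf_bot_eq])
      rw [Prod.snd_inf, hx hx', hy hy', inf_top_eq])

variable {T T' S S' : Type*} [PartialOrder T] [BoundedOrder T] [PartialOrder T'] [BoundedOrder T']
  [PartialOrder S] [BoundedOrder S] [PartialOrder S'] [BoundedOrder S']

def prodIso (φ : T ≃o S) (ψ : T' ≃o S') : T × T' ≃o S × S' where
  toEquiv := φ.toEquiv.prodCongr ψ.toEquiv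
  map_rel_iff' {t t'} := by
    change (φ t.1, ψ t.2) ≤ (φ t'.1, ψ t'.2) ↔ t ≤ t'
    rw [Prod.mk_le_mk, φ.le_iff_le, ψ.le_iff_le, Prod.le_def]

def glueCongr (φ : T ≃o S) (ψ : T' ≃o S') : Glue T T' ≃o Glue S S' where
  toFun t := ⟨(φ t.1.1, ψ t.1.2), fun h => by
    change ψ t.1.2 = ⊤
    rw [t.2 fun h' => h (by rw [h', map_bot]), map_top]⟩
  invFun t := ⟨(φ.symm t.1.1, ψ.symm t.1.2), fun h => by
    change ψ.symm t.1.2 = ⊤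
    rw [t.2 fun h' => h (by rw [h', map_bot]), map_top]⟩
  left_inv t := by simp
  right_inv t := by simp
  map_rel_iff' := (prodIso φ ψ).map_rel_iff

/-- With `BoundedFamily K` replaced by the lattice `XSatIdeal K`, each type becomes a lattice by
construction; type IV is first turned back into a gluing. -/
theorem exists_isLUB_isGLB_of_hasLatticeType {K : Type*} [Field K] {α : Type*} [PartialOrder α]
    {t : LatticeType} (h : HasLatticeType K α t) (a b : α) :
    (∃ M, IsLUB {a, b} M) ∧ ∃ N, IsGLB {a, b} N := by
  have ψ : BoundedFamily K ≃o XSatIdeal K := XSatIdeal.boundedFamilyIso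
  cases t <;> obtain ⟨φ⟩ := h
  · exact exists_isLUB_isGLB φ a b
  · exact exists_isLUB_isGLB (φ.trans ψ) a b
  · exact exists_isLUB_isGLB (φ.trans ψ.withBotCongr) a b
  · exact exists_isLUB_isGLB (φ.trans ((glueWithBotIso _).symm.trans
      (glueCongr ψ ((withTopWithBotIso _).trans ψ)))) a b
  · exact exists_isLUB_isGLB φ a b
  · exact exists_isLUB_isGLB (φ.trans ψ.withTopCongr) a b
  · exact exists_isLUB_isGLB φ a b
  · exact exists_isLUB_isGLB (φ.trans (prodIso ψ (OrderIso.refl _))) a b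
  · exact exists_isLUB_isGLB (φ.trans (prodIso ψ ψ)) a b

end Lattice

/-! ### Order properties that separate the nine types -/

section Invariants

/-- Two elements, neither of which is the greatest one, without a common proper upper bound. -/
def HasCodisjointPair (α : Type*) [LE α] : Prop :=
  ∃ x y : α, ¬ IsTop x ∧ ¬ IsTop y ∧ ∀ z, x ≤ z → y ≤ z → IsTop z

/-- Two elements, neither of which is the least one, with no lower bound but the least one. -/
def HasDisjointPair (α : Type*) [LE α] : Prop :=
  ∃ x y : α, ¬ IsBot x ∧ ¬ IsBot y ∧ ∀ z, z ≤ x → z ≤ y → IsBot z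

def HasAtom (α : Type*) [LE α] : Prop :=
  ∃ x : α, ¬ IsBot x ∧ ∀ y ≤ x, IsBot y ∨ x ≤ y

/-- An element that is comparable to all others, and neither the least nor the greatest one. -/
def HasCut (α : Type*) [LE α] : Prop :=
  ∃ x : α, ¬ IsBot x ∧ ¬ IsTop x ∧ ∀ y, x ≤ y ∨ y ≤ x

section Iso

variable {α β : Type*} [PartialOrder α] [PartialOrder β]

theorem isTop_map_iff (φ : α ≃o β) {x : α} : IsTop (φ x) ↔ IsTop x :=
  ⟨fun h y => φ.le_iff_le.1 (h (φ y)), fun h y => by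
    rw [← φ.apply_symm_apply y, φ.le_iff_le]
    exact h _⟩

theorem isBot_map_iff (φ : α ≃o β) {x : α} : IsBot (φ x) ↔ IsBot x :=
  ⟨fun h y => φ.le_iff_le.1 (h (φ y)), fun h y => by
    rw [← φ.apply_symm_apply y, φ.le_iff_le]
    exact h _⟩

theorem hasCodisjointPair_congr (φ : α ≃o β) : HasCodisjointPair α ↔ HasCodisjointPair β := by
  simp only [HasCodisjointPair, φ.le_iff_le, isTop_map_iff φ,
    φ.surjective.exists, φ.surjective.forall]

theorem hasDisjointPair_congr (φ : α ≃o β) : HasDisjointPair α ↔ HasDisjointPair β := by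
  simp only [HasDisjointPair, φ.le_iff_le, isBot_map_iff φ, φ.surjective.exists,
    φ.surjective.forall]

theorem hasAtom_congr (φ : α ≃o β) : HasAtom α ↔ HasAtom β := by
  simp only [HasAtom, φ.le_iff_le, isBot_map_iff φ, φ.surjective.exists, φ.surjective.forall]

theorem hasCut_congr (φ : α ≃o β) : HasCut α ↔ HasCut β := by
  simp only [HasCut, φ.le_iff_le, isBot_map_iff φ, isTop_map_iff φ, φ.surjective.exists,
    φ.surjective.forall]

end Iso

section Constructions

variable {α β : Type*} [PartialOrder α] [PartialOrder β]

theorem HasCodisjointPair.withBot (h : HasCodisjointPair α) : HasCodisjointPair (WithBot α) := by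
  obtain ⟨x, y, hx, hy, h⟩ := h
  refine ⟨x, y, fun hx' => hx fun z => WithBot.coe_le_coe.1 (hx' z),
    fun hy' => hy fun z => WithBot.coe_le_coe.1 (hy' z), fun z hxz hyz => ?_⟩
  induction z using WithBot.recBotCoe with
  | bot => exact absurd (le_bot_iff.1 hxz) WithBot.coe_ne_bot
  | coe z =>
    intro w
    induction w using WithBot.recBotCoe with
    | bot => exact bot_le
    | coe w => exact WithBot.coe_le_coe.2 (h z (WithBot.coe_le_coe.1 hxz)
        (WithBot.coe_le_coe.1 hyz) w)

theorem HasCodisjointPair.sumLex (h : HasCodisjointPair β) : HasCodisjointPair (α ⊕ₗ β) := by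
  obtain ⟨x, y, hx, hy, h⟩ := h
  refine ⟨toLex (.inr x), toLex (.inr y),
    fun hx' => hx fun z => Sum.Lex.inr_le_inr_iff.1 (hx' (toLex (.inr z))),
    fun hy' => hy fun z => Sum.Lex.inr_le_inr_iff.1 (hy' (toLex (.inr z))), ?_⟩
  rintro (z | z) hxz hyz
  · exact absurd hxz Sum.Lex.not_inr_le_inl
  · rintro (w | w)
    · exact Sum.Lex.inl_le_inr _ _
    · exact Sum.Lex.inr_le_inr_iff.2 (h z (Sum.Lex.inr_le_inr_iff.1 hxz)
        (Sum.Lex.inr_le_inr_iff.1 hyz) w)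

/-- The old top is a common proper upper bound of all elements other than the new top. -/
theorem not_hasCodisjointPair_withTop [OrderTop α] : ¬ HasCodisjointPair (WithTop α) := by
  rintro ⟨x, y, hx, hy, h⟩
  have key : ∀ x : WithTop α, ¬ IsTop x → x ≤ (⊤ : α) := by
    intro x hx
    induction x using WithTop.recTopCoe with
    | top => exact absurd isTop_top hx
    | coe x => exact WithTop.coe_le_coe.2 le_top
  exact WithTop.coe_ne_top (top_le_iff.1 (h _ (key x hx) (key y hy) ⊤))

theorem hasAtom_withBot [OrderBot α] : HasAtom (WithBot α) := by
  refine ⟨(⊥ : α), fun h => WithBot.coe_ne_bot (le_bot_iff.1 (h ⊥)), fun y _ => ?_⟩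
  induction y using WithBot.recBotCoe with
  | bot => exact .inl isBot_bot
  | coe y => exact .inr (WithBot.coe_le_coe.2 bot_le)

theorem not_hasAtom_withBot [NoMinOrder α] : ¬ HasAtom (WithBot α) := by
  rintro ⟨x, hx, h⟩
  induction x using WithBot.recBotCoe with
  | bot => exact hx isBot_bot
  | coe x =>
    obtain ⟨y, hy⟩ := exists_lt x
    rcases h y (WithBot.coe_le_coe.2 hy.le) with h' | h'
    · exact WithBot.coe_ne_bot (le_bot_iff.1 (h' ⊥))
    · exact hy.not_ge (WithBot.coe_le_coe.1 h')

theorem hasCut_withBot [OrderBot α] [Nontrivial α] : HasCut (WithBot α) := by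
  refine ⟨(⊥ : α), fun h => WithBot.coe_ne_bot (le_bot_iff.1 (h ⊥)), fun h => ?_, fun y => ?_⟩
  · obtain ⟨x, hx⟩ := exists_ne (⊥ : α)
    exact hx (le_bot_iff.1 (WithBot.coe_le_coe.1 (h x)))
  · induction y using WithBot.recBotCoe with
    | bot => exact .inr bot_le
    | coe y => exact .inl (WithBot.coe_le_coe.2 bot_le)

theorem hasCut_withTop [OrderTop α] [Nontrivial α] : HasCut (WithTop α) := by
  refine ⟨(⊤ : α), fun h => ?_, fun h => WithTop.coe_ne_top (top_le_iff.1 (h ⊤)), fun y => ?_⟩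
  · obtain ⟨x, hx⟩ := exists_ne (⊤ : α)
    exact hx (top_le_iff.1 (WithTop.coe_le_coe.1 (h x)))
  · induction y using WithTop.recTopCoe with
    | top => exact .inl le_top
    | coe y => exact .inr (WithTop.coe_le_coe.2 le_top)

theorem hasCut_withBot_sumLex [Nonempty α] [OrderBot β] [Nontrivial β] :
    HasCut (WithBot (α ⊕ₗ β)) := by
  refine ⟨((toLex (.inr ⊥) : α ⊕ₗ β) : WithBot (α ⊕ₗ β)),
    fun h => WithBot.coe_ne_bot (le_bot_iff.1 (h ⊥)), fun h => ?_, fun y => ?_⟩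
  · obtain ⟨x, hx⟩ := exists_ne (⊥ : β)
    exact hx (le_bot_iff.1 (Sum.Lex.inr_le_inr_iff.1
      (WithBot.coe_le_coe.1 (h (toLex (.inr x) : α ⊕ₗ β)))))
  · induction y using WithBot.recBotCoe with
    | bot => exact .inr bot_le
    | coe y =>
      rcases y with y | y
      · exact .inr (WithBot.coe_le_coe.2 (Sum.Lex.inl_le_inr _ _))
      · exact .inl (WithBot.coe_le_coe.2 (Sum.Lex.inr_le_inr_iff.2 bot_le))

section Prod

/-- A component of an atom that is not least in its factor would be an atom there; vary that
component alone. -/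
theorem not_hasAtom_prod (hα : ¬ HasAtom α) (hβ : ¬ HasAtom β) : ¬ HasAtom (α × β) := by
  rintro ⟨⟨a, b⟩, hab, h⟩
  by_cases ha : IsBot a
  · refine hβ ⟨b, fun hb => hab (ha.prodMk hb), fun b' hb' => ?_⟩
    rcases h (a, b') ⟨le_rfl, hb'⟩ with h' | h'
    exacts [.inl h'.snd, .inr h'.2]
  · refine hα ⟨a, ha, fun a' ha' => ?_⟩
    rcases h (a', b) ⟨ha', le_rfl⟩ with h' | h'
    exacts [.inl h'.fst, .inr h'.1]

variable [BoundedOrder α] [BoundedOrder β]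

theorem hasAtom_prod_fin_two : HasAtom (α × Fin 2) := by
  refine ⟨(⊥, 1), fun h => absurd (h (⊥, 0)).2 (show ¬ (1 : Fin 2) ≤ 0 by decide), ?_⟩
  rintro ⟨a, b⟩ ⟨h1, -⟩
  obtain rfl : a = ⊥ := le_bot_iff.1 h1
  match b with
  | 0 => exact .inl fun z => ⟨bot_le, Fin.zero_le _⟩
  | 1 => exact .inr le_rfl

variable [Nontrivial α] [Nontrivial β]

theorem hasCodisjointPair_prod : HasCodisjointPair (α × β) := by
  refine ⟨(⊤, ⊥), (⊥, ⊤), fun h => bot_ne_top (top_le_iff.1 (h (⊤, ⊤)).2),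
    fun h => bot_ne_top (top_le_iff.1 (h (⊤, ⊤)).1), fun z h1 h2 w => ?_⟩
  exact ⟨le_top.trans h1.1, le_top.trans h2.2⟩

theorem hasDisjointPair_prod : HasDisjointPair (α × β) := by
  refine ⟨(⊤, ⊥), (⊥, ⊤), fun h => top_ne_bot (le_bot_iff.1 (h (⊥, ⊥)).1),
    fun h => top_ne_bot (le_bot_iff.1 (h (⊥, ⊥)).2), fun z h1 h2 w => ?_⟩
  exact ⟨h2.1.trans bot_le, h1.2.trans bot_le⟩

/-- Comparability with `(⊤, ⊥)` and with `(⊥, ⊤)` already forces both components to be top or both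
to be bottom. -/
theorem not_hasCut_prod : ¬ HasCut (α × β) := by
  rintro ⟨⟨a, b⟩, h1, h2, h⟩
  have key : (a = ⊤ ∧ b = ⊤) ∨ (a = ⊥ ∧ b = ⊥) := by
    rcases h (⊤, ⊥) with ⟨-, h3⟩ | ⟨h3, -⟩ <;> rcases h (⊥, ⊤) with ⟨h4, -⟩ | ⟨-, h4⟩
    · exact .inr ⟨le_bot_iff.1 h4, le_bot_iff.1 h3⟩
    · exact absurd ((top_le_iff.1 h4).symm.trans (le_bot_iff.1 h3)) top_ne_bot
    · exact absurd ((top_le_iff.1 h3).symm.trans (le_bot_iff.1 h4)) top_ne_bot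
    · exact .inl ⟨top_le_iff.1 h3, top_le_iff.1 h4⟩
  rcases key with ⟨rfl, rfl⟩ | ⟨rfl, rfl⟩
  exacts [h2 fun z => ⟨le_top, le_top⟩, h1 fun z => ⟨bot_le, bot_le⟩]

end Prod

end Constructions

section Family

variable (K : Type*) [Field K]

/-- A member of the family that is coprime to a given one. -/
theorem exists_isCoprime (p : PolyFamily K) : ∃ q : PolyFamily K, IsCoprime p.1 q.1 := by
  have h1 : (X * p.1).Monic := monic_X.mul p.2.1
  have hdeg : (1 : K[X]).degree < (X * p.1).degree := by
    rw [degree_one, degree_eq_natDegree h1.ne_zero, natDegree_X_mul p.2.1.ne_zero]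
    exact_mod_cast Nat.succ_pos _
  -- Euclid's trick: `X p + 1` has constant term `1`, and subtracting `X p` from it leaves `1`.
  refine ⟨⟨X * p.1 + 1, h1.add_of_left hdeg, by simp, fun h => ?_⟩, -X, 1, by ring⟩
  exact h1.ne_zero (by simpa using h)

theorem isCoprime_not_le {p q : PolyFamily K} (h : IsCoprime p.1 q.1) : ¬ p ≤ q := fun hle =>
  q.2.2.2 (q.2.1.isUnit_iff.1 (h.isUnit_of_dvd' hle dvd_rfl))

instance : Nonempty (PolyFamily K) :=
  ⟨⟨X - C 1, monic_X_sub_C 1, by simp, fun h => by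
    simpa only [natDegree_X_sub_C, natDegree_one, one_ne_zero] using congrArg natDegree h⟩⟩

theorem mul_mem_family (p q : PolyFamily K) :
    (p.1 * q.1).Monic ∧ (p.1 * q.1).coeff 0 ≠ 0 ∧ p.1 * q.1 ≠ 1 := by
  refine ⟨p.2.1.mul q.2.1, ?_, fun h => ?_⟩
  · rw [mul_coeff_zero]
    exact mul_ne_zero p.2.2.1 q.2.2.1
  · exact p.2.2.2 (p.2.1.isUnit_iff.1 (IsUnit.of_mul_eq_one _ h))

theorem exists_le_le (p q : PolyFamily K) : ∃ r : PolyFamily K, r ≤ p ∧ r ≤ q :=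
  ⟨⟨p.1 * q.1, mul_mem_family K p q⟩, Dvd.intro _ rfl, Dvd.intro_left _ rfl⟩

/-- Multiplying by a coprime member gives a strictly smaller one, so `0 < P < L` has no atom, over
any field. -/
instance : NoMinOrder (PolyFamily K) where
  exists_lt p := by
    obtain ⟨q, hq⟩ := exists_isCoprime K p
    refine ⟨⟨p.1 * q.1, mul_mem_family K p q⟩, lt_of_le_not_ge (Dvd.intro _ rfl) fun h => ?_⟩
    exact isCoprime_not_le K hq ((Dvd.intro_left _ rfl : q.1 ∣ p.1 * q.1).trans h)

theorem hasCodisjointPair_withTop_family : HasCodisjointPair (WithTop (PolyFamily K)) := by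
  obtain ⟨p⟩ := (inferInstance : Nonempty (PolyFamily K))
  obtain ⟨q, hq⟩ := exists_isCoprime K p
  refine ⟨p, q, fun h => WithTop.coe_ne_top (top_le_iff.1 (h ⊤)),
    fun h => WithTop.coe_ne_top (top_le_iff.1 (h ⊤)), fun z hp hq' => ?_⟩
  induction z using WithTop.recTopCoe with
  | top => exact isTop_top
  | coe z =>
    exact absurd (z.2.1.isUnit_iff.1 (hq.isUnit_of_dvd' (WithTop.coe_le_coe.1 hp)
      (WithTop.coe_le_coe.1 hq'))) z.2.2.2

theorem not_hasCut_boundedFamily : ¬ HasCut (BoundedFamily K) := by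
  rintro ⟨x, h1, h2, h⟩
  induction x using WithBot.recBotCoe with
  | bot => exact h1 isBot_bot
  | coe x =>
    induction x using WithTop.recTopCoe with
    | top => exact h2 isTop_top
    | coe p =>
      obtain ⟨q, hq⟩ := exists_isCoprime K p
      rcases h ((q : WithTop (PolyFamily K)) : BoundedFamily K) with h3 | h3
      · exact isCoprime_not_le K hq (WithTop.coe_le_coe.1 (WithBot.coe_le_coe.1 h3))
      · exact isCoprime_not_le K hq.symm (WithTop.coe_le_coe.1 (WithBot.coe_le_coe.1 h3))

/-- Nonzero elements dominate members of the family, and the product of two members lies below both.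
-/
theorem not_hasDisjointPair_boundedFamily : ¬ HasDisjointPair (BoundedFamily K) := by
  have key : ∀ a : WithTop (PolyFamily K), ∃ p : PolyFamily K, (p : WithTop (PolyFamily K)) ≤ a := by
    intro a
    induction a using WithTop.recTopCoe with
    | top => exact ⟨Classical.arbitrary _, le_top⟩
    | coe p => exact ⟨p, le_rfl⟩
  rintro ⟨x, y, hx, hy, h⟩
  induction x using WithBot.recBotCoe with
  | bot => exact hx isBot_bot
  | coe x =>
    induction y using WithBot.recBotCoe with
    | bot => exact hy isBot_bot
    | coe y =>
      obtain ⟨p, hp⟩ := key x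
      obtain ⟨q, hq⟩ := key y
      obtain ⟨r, hr, hr'⟩ := exists_le_le K p q
      have h1 := h ((r : WithTop (PolyFamily K)) : BoundedFamily K)
        (WithBot.coe_le_coe.2 ((WithTop.coe_le_coe.2 hr).trans hp))
        (WithBot.coe_le_coe.2 ((WithTop.coe_le_coe.2 hr').trans hq))
      exact WithBot.coe_ne_bot (le_bot_iff.1 (h1 ⊥))

instance : Infinite (BoundedFamily K) :=
  have : Infinite (PolyFamily K) := NoMinOrder.infinite
  Infinite.of_injective (fun p : PolyFamily K => ((p : WithTop (PolyFamily K)) : BoundedFamily K))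
    (WithBot.coe_injective.comp WithTop.coe_injective)

end Family

section Table

instance : DecidableEq LatticeType := fun t t' =>
  decidable_of_iff (t.ctorIdx = t'.ctorIdx)
    ⟨fun h => by cases t <;> cases t' <;> first | rfl | exact absurd h (by decide),
      fun h => congrArg _ h⟩

variable {K : Type*} [Field K] {α : Type*} [PartialOrder α] {t : LatticeType}

theorem hasCodisjointPair_iff (h : HasLatticeType K α t) :
    HasCodisjointPair α ↔ t ≠ .I ∧ t ≠ .V ∧ t ≠ .VI := by
  have hB : HasCodisjointPair (BoundedFamily K) := (hasCodisjointPair_withTop_family K).withBot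
  cases t <;> obtain ⟨φ⟩ := h <;> rw [hasCodisjointPair_congr φ]
  · simp only [HasCodisjointPair, IsTop]
    decide
  · simpa
  · simpa using hB.withBot
  · simpa using hB.sumLex.withBot
  · simp only [HasCodisjointPair, IsTop]
    decide
  · simpa using not_hasCodisjointPair_withTop
  all_goals simpa using hasCodisjointPair_prod

theorem hasAtom_iff (h : HasLatticeType K α t) :
    HasAtom α ↔ t ≠ .II ∧ t ≠ .IV ∧ t ≠ .VI ∧ t ≠ .IX := by
  have hB : ¬ HasAtom (BoundedFamily K) := not_hasAtom_withBot
  cases t <;> obtain ⟨φ⟩ := h <;> rw [hasAtom_congr φ]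
  · simp only [HasAtom, IsBot]
    decide
  · simpa
  · simpa using hasAtom_withBot
  · simpa using not_hasAtom_withBot
  · simp only [HasAtom, IsBot]
    decide
  · rw [hasAtom_congr (withTopWithBotIso _)]
    simpa using not_hasAtom_withBot
  · simpa using hasAtom_prod_fin_two
  · simpa using hasAtom_prod_fin_two
  · simpa using not_hasAtom_prod hB hB

theorem hasCut_iff (h : HasLatticeType K α t) :
    HasCut α ↔ t = .III ∨ t = .IV ∨ t = .V ∨ t = .VI := by
  cases t <;> obtain ⟨φ⟩ := h <;> rw [hasCut_congr φ]
  · simp only [HasCut, IsTop, IsBot]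
    decide
  · simpa using not_hasCut_boundedFamily K
  · simpa using hasCut_withBot
  · simpa using hasCut_withBot_sumLex
  · simp only [HasCut, IsTop, IsBot]
    decide
  · simpa using hasCut_withTop
  all_goals simpa using not_hasCut_prod

/-- Codisjoint pairs, atoms and cuts separate all types except two pairs. II and IX differ because
only the product has a disjoint pair, VII and VIII because only the former is finite. -/
theorem type_eq {t' : LatticeType} (h : HasLatticeType K α t) (h' : HasLatticeType K α t') :
    t = t' := by
  have h1 := (hasCodisjointPair_iff h).symm.trans (hasCodisjointPair_iff h')
  have h2 := (hasAtom_iff h).symm.trans (hasAtom_iff h')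
  have h3 := (hasCut_iff h).symm.trans (hasCut_iff h')
  have h4 : HasLatticeType K α .II → HasLatticeType K α .IX → False := fun ⟨φ⟩ ⟨ψ⟩ =>
    not_hasDisjointPair_boundedFamily K
      ((hasDisjointPair_congr (ψ.symm.trans φ)).1 hasDisjointPair_prod)
  have h5 : HasLatticeType K α .VII → HasLatticeType K α .VIII → False := fun ⟨φ⟩ ⟨ψ⟩ =>
    not_finite_iff_infinite.2 (inferInstance : Infinite (BoundedFamily K × Fin 2))
      (Finite.of_equiv _ (φ.symm.trans ψ).toEquiv)
  cases t <;> cases t' <;> first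
    | rfl
    | exact (h4 h h').elim
    | exact (h4 h' h).elim
    | exact (h5 h h').elim
    | exact (h5 h' h).elim
    | exact absurd h1 (by decide)
    | exact absurd h2 (by decide)
    | exact absurd h3 (by decide)

theorem nonempty_iso_of_hasLatticeType {β : Type*} [PartialOrder β] (h : HasLatticeType K α t)
    (h' : HasLatticeType K β t) : Nonempty (α ≃o β) := by
  cases t <;> obtain ⟨φ⟩ := h <;> obtain ⟨ψ⟩ := h' <;> exact ⟨φ.trans ψ.symm⟩

theorem exists_mem_representativeTable (t : LatticeType) : ∃ x ∈ representativeTable, x.2 = t := by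
  cases t <;> simp [representativeTable]

end Table

end Invariants

end Leavitt

/-! ### The classification theorem -/

theorem theorem4 (K : Type*) [Field K] :
    (∀ (V Ed : Type*) [Fintype V] [DecidableEq V] [Fintype Ed] (E : DirGraph V Ed),
      Fintype.card V = 2 →
        -- the λ-reducible ideals form a lattice under inclusion
        (∀ I J : LambdaIdeals K E, (∃ M, IsLUB {I, J} M) ∧ (∃ N, IsGLB {I, J} N)) ∧
        -- which is of exactly one of the nine types
        (∃! t : LatticeType, HasLatticeType K (LambdaIdeals K E) t) ∧
        -- and isomorphic to that of one of the sixteen representative graphs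
        (∃ x ∈ representativeTable, Nonempty
          (LambdaIdeals K E ≃o LambdaIdeals K (twoVertexGraph x.1.1 x.1.2.1 x.1.2.2.1 x.1.2.2.2)))) ∧
    -- each representative graph has the tabulated type, and all nine types occur
    (∀ x ∈ representativeTable,
      HasLatticeType K
        (LambdaIdeals K (twoVertexGraph x.1.1 x.1.2.1 x.1.2.2.1 x.1.2.2.2)) x.2) ∧
    (∀ t : LatticeType, ∃ x ∈ representativeTable, x.2 = t) := by
  refine ⟨?_, Leavitt.hasType_representative K, Leavitt.exists_mem_representativeTable⟩
  intro V Ed _ _ _ E hcard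
  obtain ⟨t, ht⟩ := Leavitt.exists_hasLatticeType (K := K) (E := E) hcard
  refine ⟨Leavitt.exists_isLUB_isGLB_of_hasLatticeType ht,
    ⟨t, ht, fun t' ht' => Leavitt.type_eq ht' ht⟩, ?_⟩
  obtain ⟨x, hx, rfl⟩ := Leavitt.exists_mem_representativeTable t
  exact ⟨x, hx, Leavitt.nonempty_iso_of_hasLatticeType ht
    (Leavitt.hasType_representative K x hx)⟩
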